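/- **Theorem 1.3 (Equivariant De Rham's Approximation Theorem).** Let $\mathcal M$ be a smooth $n$-manifold (Hausdorff, second countable, without boundary), let $\mathcal G$ be a compact Lie group acting smoothly on $\mathcal M$, and write $\alpha^g(x)=g\cdot x$. Let $\mathscr D^m(\mathcal M)$ be the space of compactly supported $C^\infty$ $m$-forms on $\mathcal M$ and $\mathscr D_m(\mathcal M)$ the space of $m$-currents, i.e. of continuous linear functionals on $\mathscr D^m(\mathcal M)$. A current $T$ is $\mathcal G$-invariant if $(\alpha^g)_*T=T$, i.e. $T((\alpha^g)^*\omega)=T(\omega)$ for all $\omega$, for every $g\in\mathcal G$. It is of class $C^\infty$ if in every smooth chart it has $C^\infty$ coefficients, i.e. $T(\omega)=\int\sum_I f_I\,\omega_I\,dy$ with $C^\infty$ functions $f_I$ for all $\omega=\sum_I\omega_I\,dy_I\in\mathscr D^m(\mathcal M)$ supported in the chart. Then there are linear operators $\mathcal Z_{\mathcal G}=\mathcal Z_{\mathcal G,\varepsilon}\colon\mathscr D_m(\mathcal M)\to\mathscr D_m(\mathcal M)$, depending on a number $\varepsilon>0$, such that for every $\mathcal G$-invariant $m$-current $T$ on $\mathcal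 M$: (a) $\mathcal Z_{\mathcal G}T$ is an $m$-current of class $C^\infty$ for every $\varepsilon>0$; (b) $\mathcal Z_{\mathcal G}T$ is $\mathcal G$-invariant for every $\varepsilon>0$; (c) $\mathcal Z_{\mathcal G}T$ converges weakly to $T$ as $\varepsilon\to0$, i.e. $\mathcal Z_{\mathcal G,\varepsilon}T(\omega)\to T(\omega)$ for every $\omega\in\mathscr D^m(\mathcal M)$. -/

import Mathlib

open Set Filter Topology MeasureTheory
open scoped Manifold ContDiff

noncomputable section

namespace DeRham

/-- An arbitrary (not necessarily smooth) field of alternating `m`-linear forms on the tangent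
spaces of the `n`-dimensional manifold `M`. -/
abbrev FormField (n : ℕ) (M : Type*) [TopologicalSpace M]
    [ChartedSpace (EuclideanSpace ℝ (Fin n)) M] (m : ℕ) : Type _ :=
  ∀ x : M, TangentSpace (𝓡 n) x [⋀^Fin m]→L[ℝ] ℝ

section Forms

variable {n m : ℕ} {M : Type*} [TopologicalSpace M]
  [ChartedSpace (EuclideanSpace ℝ (Fin n)) M]

/-- The expression `(e⁻¹)^* α` of `α` in the chart `e`, a form on `ℝⁿ` (meaningful on
`e.target`). Its values on tuples of standard basis vectors are the coefficients of `α`. -/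
def chartRep (e : OpenPartialHomeomorph M (EuclideanSpace ℝ (Fin n))) (α : FormField n M m)
    (y : EuclideanSpace ℝ (Fin n)) : EuclideanSpace ℝ (Fin n) [⋀^Fin m]→L[ℝ] ℝ :=
  (α (e.symm y)).compContinuousLinearMap
    (mfderiv (𝓡 n) (𝓡 n) e.symm y :
      EuclideanSpace ℝ (Fin n) →L[ℝ] TangentSpace (𝓡 n) (e.symm y))

/-- The support of `α`. -/
def formSupport (α : FormField n M m) : Set M := closure {x | α x ≠ 0}

/-- `α` is of class `C^∞`: its coefficients in every smooth chart are. -/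
def IsSmoothForm (α : FormField n M m) : Prop :=
  ∀ e ∈ IsManifold.maximalAtlas (𝓡 n) ∞ M, ContDiffOn ℝ ∞ (chartRep e α) e.target

/-- The pullback `f^* α`, that is `(f^* α)_x (v₁, …, v_m) = α_{f x} (df_x v₁, …, df_x v_m)`. -/
def pullbackField (f : M → M) (α : FormField n M m) : FormField n M m :=
  fun x => (α (f x)).compContinuousLinearMap (mfderiv (𝓡 n) (𝓡 n) f x)

theorem chartRep_add (e : OpenPartialHomeomorph M (EuclideanSpace ℝ (Fin n)))
    (α η : FormField n M m) : chartRep e (α + η) = chartRep e α + chartRep e η := rfl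

theorem chartRep_smul (e : OpenPartialHomeomorph M (EuclideanSpace ℝ (Fin n)))
    (c : ℝ) (α : FormField n M m) : chartRep e (c • α) = c • chartRep e α := rfl

theorem chartRep_zero (e : OpenPartialHomeomorph M (EuclideanSpace ℝ (Fin n))) :
    chartRep e (0 : FormField n M m) = 0 := rfl

theorem formSupport_zero : formSupport (0 : FormField n M m) = ∅ := by
  simp [formSupport]

theorem formSupport_add (α η : FormField n M m) :
    formSupport (α + η) ⊆ formSupport α ∪ formSupport η := by
  rw [formSupport, formSupport, formSupport, ← closure_union]
  refine closure_mono fun x hx => ?_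
  by_contra h
  simp only [mem_union, mem_ofPred_eq, not_or, not_not] at h
  exact hx (by simp [h.1, h.2])

theorem formSupport_smul (c : ℝ) (α : FormField n M m) :
    formSupport (c • α) ⊆ formSupport α := by
  refine closure_mono fun x hx => ?_
  intro h
  exact hx (by simp [h])

end Forms

/-- The space `𝒟^m(M)` of `C^∞` differential `m`-forms with compact support on `M`. -/
def testForms (n : ℕ) (M : Type*) [TopologicalSpace M]
    [ChartedSpace (EuclideanSpace ℝ (Fin n)) M] (m : ℕ) : Submodule ℝ (FormField n M m) where
  carrier := {α | IsSmoothForm α ∧ IsCompact (formSupport α)}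
  zero_mem' := by
    refine ⟨fun e _ => ?_, ?_⟩
    · rw [chartRep_zero]
      exact contDiffOn_const
    · rw [formSupport_zero]
      exact isCompact_empty
  add_mem' := by
    rintro α η ⟨h1, h2⟩ ⟨h3, h4⟩
    refine ⟨fun e he => ?_, ?_⟩
    · rw [chartRep_add]
      exact (h1 e he).add (h3 e he)
    · exact (h2.union h4).of_isClosed_subset isClosed_closure (formSupport_add α η)
  smul_mem' := by
    rintro c α ⟨h1, h2⟩
    refine ⟨fun e he => ?_, ?_⟩
    · rw [chartRep_smul]
      exact contDiffOn_const.smul (h1 e he)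
    · exact h2.of_isClosed_subset isClosed_closure (formSupport_smul c α)

/-- The pullback `A^* α` of an alternating form by a linear map depends smoothly on `(α, A)`. -/
theorem contDiff_compContinuousLinearMap (n m : ℕ) :
    ContDiff ℝ ∞ (fun p : (EuclideanSpace ℝ (Fin n) [⋀^Fin m]→L[ℝ] ℝ) ×
      (EuclideanSpace ℝ (Fin n) →L[ℝ] EuclideanSpace ℝ (Fin n)) =>
        p.1.compContinuousLinearMap p.2) := by
  let E := EuclideanSpace ℝ (Fin n)
  have : FiniteDimensional ℝ (ContinuousMultilinearMap ℝ (fun _ : Fin m => E) ℝ) :=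
    Module.Finite.of_injective
      (ContinuousMultilinearMap.toMultilinearMapLinear :
        ContinuousMultilinearMap ℝ (fun _ : Fin m => E) ℝ →ₗ[ℝ]
          MultilinearMap ℝ (fun _ : Fin m => E) ℝ)
      ContinuousMultilinearMap.toMultilinearMap_injective
  let J : (E [⋀^Fin m]→L[ℝ] ℝ) →L[ℝ] ContinuousMultilinearMap ℝ (fun _ : Fin m => E) ℝ :=
    ContinuousAlternatingMap.toContinuousMultilinearMapCLM ℝ
  have hJ : LinearMap.ker (J : (E [⋀^Fin m]→L[ℝ] ℝ) →ₗ[ℝ]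
      ContinuousMultilinearMap ℝ (fun _ : Fin m => E) ℝ) = ⊥ :=
    LinearMap.ker_eq_bot.2 fun _ _ h =>
      ContinuousAlternatingMap.toContinuousMultilinearMap_injective h
  obtain ⟨P, hP⟩ := LinearMap.exists_leftInverse_of_injective _ hJ
  have hc : ContDiff ℝ ∞ (fun p : (Fin m → E →L[ℝ] E) ×
      ContinuousMultilinearMap ℝ (fun _ : Fin m => E) ℝ => p.2.compContinuousLinearMap p.1) :=
    contDiff_iff_contDiffAt.2 fun q =>
      (ContinuousMultilinearMap.cpolynomialAt_uncurry_compContinuousLinearMap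
        (𝕜 := ℝ) (Fm := fun _ : Fin m => E) (Em := fun _ : Fin m => E) (G := ℝ)
        (q := q)).analyticAt.contDiffAt
  have hd : ContDiff ℝ ∞ (fun p : (E [⋀^Fin m]→L[ℝ] ℝ) × (E →L[ℝ] E) =>
      LinearMap.toContinuousLinearMap P
        ((J p.1).compContinuousLinearMap (fun _ : Fin m => p.2))) := by
    refine (LinearMap.toContinuousLinearMap P).contDiff.comp
      (hc.comp (f := fun p : (E [⋀^Fin m]→L[ℝ] ℝ) × (E →L[ℝ] E) =>
        ((fun _ : Fin m => p.2), J p.1)) ?_)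
    exact (contDiff_pi.2 fun _ => contDiff_snd).prodMk (J.contDiff.comp contDiff_fst)
  convert hd using 1
  funext p
  exact (LinearMap.congr_fun hP (p.1.compContinuousLinearMap p.2)).symm

section Pullback

variable {n m : ℕ} {M : Type*} [TopologicalSpace M]
  [ChartedSpace (EuclideanSpace ℝ (Fin n)) M]

theorem isSmoothForm_pullbackField [IsManifold (𝓡 n) ∞ M] {f : M → M} (hf : ContMDiff (𝓡 n) (𝓡 n) ∞ f)
    {α : FormField n M m} (hα : IsSmoothForm α) : IsSmoothForm (pullbackField f α) := by
  intro e he y₀ hy₀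
  refine ContDiffAt.contDiffWithinAt ?_
  let E := EuclideanSpace ℝ (Fin n)
  let e' : OpenPartialHomeomorph M E := chartAt E (f (e.symm y₀))
  have he' : e' ∈ IsManifold.maximalAtlas (𝓡 n) ∞ M := IsManifold.chart_mem_maximalAtlas _
  let g : E → E := fun y => e' (f (e.symm y))
  have hes : ∀ y ∈ e.target, ContMDiffAt (𝓡 n) (𝓡 n) ∞ e.symm y := fun y hy =>
    (contMDiffOn_symm_of_mem_maximalAtlas he).contMDiffAt (e.open_target.mem_nhds hy)
  have hfe : ∀ y ∈ e.target, ContMDiffAt (𝓡 n) (𝓡 n) ∞ (fun y => f (e.symm y)) y := fun y hy =>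
    hf.contMDiffAt.comp y (hes y hy)
  have hU : e.target ∩ (fun y => f (e.symm y)) ⁻¹' e'.source ∈ 𝓝 y₀ :=
    inter_mem (e.open_target.mem_nhds hy₀)
      ((hfe y₀ hy₀).continuousAt.preimage_mem_nhds
        (e'.open_source.mem_nhds (mem_chart_source E (f (e.symm y₀)))))
  obtain ⟨U, hUs, hUo, hyU⟩ := mem_nhds_iff.1 hU
  have hg : ∀ y ∈ U, ContDiffAt ℝ ∞ g y := fun y hy =>
    ((((contMDiffOn_of_mem_maximalAtlas he').contMDiffAt
      (e'.open_source.mem_nhds (hUs hy).2)).comp y (hfe y (hUs hy).1))).contDiffAt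
  have hgt : ∀ y ∈ U, g y ∈ e'.target := fun y hy => e'.map_source (hUs hy).2
  have key : ∀ y ∈ U, chartRep e (pullbackField f α) y =
      (chartRep e' α (g y)).compContinuousLinearMap (fderiv ℝ g y) := by
    intro y hy
    have hyt := (hUs hy).1
    have hpt : e'.symm (g y) = f (e.symm y) := e'.left_inv (hUs hy).2
    have hne : (∞ : ℕ∞ω) ≠ 0 := by simp
    have h1 : mfderiv (𝓡 n) (𝓡 n) (fun y => f (e.symm y)) y =
        (mfderiv (𝓡 n) (𝓡 n) f (e.symm y)).comp (mfderiv (𝓡 n) (𝓡 n) e.symm y) :=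
      mfderiv_comp y (hf.contMDiffAt.mdifferentiableAt hne) ((hes y hyt).mdifferentiableAt hne)
    have h2 : mfderiv (𝓡 n) (𝓡 n) (fun y => e'.symm (g y)) y =
        (mfderiv (𝓡 n) (𝓡 n) e'.symm (g y)).comp (mfderiv (𝓡 n) (𝓡 n) g y) :=
      mfderiv_comp y (((contMDiffOn_symm_of_mem_maximalAtlas he').contMDiffAt
        (e'.open_target.mem_nhds (hgt y hy))).mdifferentiableAt hne)
        ((hg y hy).contMDiffAt.mdifferentiableAt hne)
    have h3 : (fun y => e'.symm (g y)) =ᶠ[𝓝 y] fun y => f (e.symm y) := by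
      filter_upwards [hUo.mem_nhds hy] with z hz
      exact e'.left_inv (hUs hz).2
    have hcongr : ∀ (p q : M) (v w : Fin m → E), p = q → v = w →
        (α p : (Fin m → E) → ℝ) v = (α q : (Fin m → E) → ℝ) w := by
      rintro p q v w rfl rfl
      rfl
    ext v
    refine hcongr _ _ _ _ hpt.symm (funext fun i => ?_)
    have h4 := h3.mfderiv_eq (I := 𝓡 n) (I' := 𝓡 n)
    have h5 := (h1.symm.trans h4.symm).trans h2
    rw [mfderiv_eq_fderiv] at h5
    exact DFunLike.congr_fun h5 (v i)
  have hcomp : ContDiffAt ℝ ∞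
      (fun y => (chartRep e' α (g y)).compContinuousLinearMap (fderiv ℝ g y)) y₀ := by
    have a : ContDiffAt ℝ ∞ (fun y => chartRep e' α (g y)) y₀ :=
      ((hα e' he').contDiffAt (e'.open_target.mem_nhds (hgt y₀ hyU))).comp y₀ (hg y₀ hyU)
    have b : ContDiffAt ℝ ∞ (fderiv ℝ g) y₀ := (hg y₀ hyU).fderiv_right (by simp)
    exact (contDiff_compContinuousLinearMap n m).contDiffAt.comp y₀ (a.prodMk b)
  exact hcomp.congr_of_eventuallyEq (by
    filter_upwards [hUo.mem_nhds hyU] with y hy using key y hy)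

theorem pullbackField_add (f : M → M) (α β : FormField n M m) :
    pullbackField f (α + β) = pullbackField f α + pullbackField f β := rfl

theorem pullbackField_smul (f : M → M) (c : ℝ) (α : FormField n M m) :
    pullbackField f (c • α) = c • pullbackField f α := rfl

theorem formSupport_pullbackField (f : M ≃ₘ^∞⟮𝓡 n, 𝓡 n⟯ M) (α : FormField n M m) :
    formSupport (pullbackField f α) ⊆ f ⁻¹' formSupport α := by
  refine closure_minimal (fun x hx => subset_closure fun h => hx ?_)
    (isClosed_closure.preimage f.continuous)
  ext v
  simp [pullbackField, h]

/-- The pullback `f^* : 𝒟^m(M) → 𝒟^m(M)` of compactly supported smooth forms by a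
diffeomorphism `f` of `M`. -/
def pullback [IsManifold (𝓡 n) ∞ M] (f : M ≃ₘ^∞⟮𝓡 n, 𝓡 n⟯ M) :
    testForms n M m →ₗ[ℝ] testForms n M m where
  toFun α := ⟨pullbackField f α.1, isSmoothForm_pullbackField f.contMDiff α.2.1,
    (f.toHomeomorph.isCompact_preimage.2 α.2.2).of_isClosed_subset isClosed_closure
      (formSupport_pullbackField f α.1)⟩
  map_add' α β := Subtype.ext (pullbackField_add f α.1 β.1)
  map_smul' c α := Subtype.ext (pullbackField_smul f c α.1)

end Pullback

section Currents

variable {n m : ℕ} {M : Type*} [TopologicalSpace M]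
  [ChartedSpace (EuclideanSpace ℝ (Fin n)) M]

/-- Convergence `α_j → 0` in `𝒟^m(M)`: the supports of all `α_j` lie in one compact set, and in
every smooth chart all partial derivatives of all coefficients of `α_j` tend to `0`, uniformly on
compact subsets of the chart. -/
def TendstoZero (α : ℕ → testForms n M m) : Prop :=
  (∃ K : Set M, IsCompact K ∧ ∀ j, formSupport (α j : FormField n M m) ⊆ K) ∧
    ∀ e ∈ IsManifold.maximalAtlas (𝓡 n) ∞ M, ∀ L ⊆ e.target, IsCompact L → ∀ r : ℕ,
      TendstoUniformlyOn (fun j => iteratedFDeriv ℝ r (chartRep e (α j : FormField n M m)))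
        0 atTop L

variable (n m M) in
/-- The space `𝒟_m(M)` of `m`-currents on `M`: the linear functionals `T` on `𝒟^m(M)` which are
continuous, that is, `T α_j → 0` whenever `α_j → 0` (for linear functionals this sequential
condition is equivalent to continuity for the usual inductive limit topology of `𝒟^m(M)`). -/
def currents : Submodule ℝ (testForms n M m →ₗ[ℝ] ℝ) where
  carrier := {T | ∀ α : ℕ → testForms n M m, TendstoZero α →
    Tendsto (fun j => T (α j)) atTop (𝓝 0)}
  zero_mem' _ _ := tendsto_const_nhds
  add_mem' h₁ h₂ α hα := by simpa using (h₁ α hα).add (h₂ α hα)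
  smul_mem' c _ h α hα := by simpa using (h α hα).const_mul c

/-- The current `T` is of class `C^∞`: in every smooth chart it has `C^∞` coefficients, that is,
on forms `α` supported in the chart it is `T α = ∫ ∑_I f_I(y) α_I(y) dy`, where `α_I` are the
coefficients of `α` and `f_I` are `C^∞` functions (collected here into one `C^∞` function `f` with
values in the dual of the space of alternating forms). If `M` is oriented this says that
`T α = ∫_M β ∧ α` for a smooth `(n - m)`-form `β`, and in general that this holds for a smooth
`β` of odd kind (twisted by the orientation line bundle). -/
def IsSmoothCurrent (T : currents n m M) : Prop :=
  ∀ e ∈ IsManifold.maximalAtlas (𝓡 n) ∞ M,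
    ∃ f : EuclideanSpace ℝ (Fin n) → (EuclideanSpace ℝ (Fin n) [⋀^Fin m]→L[ℝ] ℝ) →L[ℝ] ℝ,
      ContDiffOn ℝ ∞ f e.target ∧
        ∀ α : testForms n M m, formSupport (α : FormField n M m) ⊆ e.source →
          T.1 α = ∫ y in e.target, f y (chartRep e (α : FormField n M m) y)

/-- The push-forward `f_* T`, given by `(f_* T)(α) = T (f^* α)`, as a linear functional on
`𝒟^m(M)`. -/
def pushforward [IsManifold (𝓡 n) ∞ M] (f : M ≃ₘ^∞⟮𝓡 n, 𝓡 n⟯ M) (T : currents n m M) :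
    testForms n M m →ₗ[ℝ] ℝ :=
  T.1 ∘ₗ pullback f

/-- For a Lie group `G` acting smoothly on `M`, the current `T` is `G`-invariant if `g_* T = T` for
the diffeomorphism `x ↦ g • x` of `M`, for every `g` in `G`. -/
def IsInvariantCurrent (k : ℕ) (G : Type*) [TopologicalSpace G]
    [ChartedSpace (EuclideanSpace ℝ (Fin k)) G] [Group G] [MulAction G M]
    [IsManifold (𝓡 n) ∞ M] [ContMDiffSMul (𝓡 k) (𝓡 n) ∞ G M] (T : currents n m M) : Prop :=
  ∀ g : G, pushforward (Diffeomorph.smul (𝓡 k) (𝓡 n) ∞ g) T = T.1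

end Currents

end DeRham

end

/-! Localize, mollify, average over the group. Take a smooth partition of unity `f_i` whose members
have compact support in charts, and let `ρ` be one of them read in its chart `e`. With `φ_ε` a
normalized bump function on `ℝⁿ`, the function `F_ε(z) a = ρ(z) T(φ_ε(· - z) a)`, for `a` an
alternating form, collects the coefficients of a mollification of `ρ T`. Pairing these coefficients
with a form `α` by integration over `z` amounts to evaluating `T` on the convolution `φ_ε * (ρ α)`.
The operator pairs the coefficients with `g^* α` instead, integrates over `g` against normalized
Haar measure, and sums over finitely many `i`.

The analytic core is that a current has finite order on a compact subset of a chart, by the usual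
contradiction argument (`exists_bound_current`). By Hahn-Banach it is then a continuous functional
`Φ` of the `r`-jet, regarded as a continuous function on that compact set (`exists_jet_functional`).
Hence `F_ε` is smooth, since translates of a smooth function depend smoothly on the translation in
the sup norm (`contDiff_translates`). The functional can also be moved through the `z`-integral: the
pairing is `Φ` of the mollified jet of `ρ α`, which converges uniformly to that jet. This gives
convergence to `T(ρ α)` and bounds uniform in `ε`.

Smoothness of the average: the change of variables `z = g⁻¹ y` moves the action from the form to the
coefficients, where it is smooth jointly in `(g, y)`, and integrating over the compact group
preserves smoothness in `y` (`isSmoothCurrent_averagedCurrent`). Invariance: `g^* h^* = (h g)^*`, so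
left invariance of Haar measure absorbs `h`. Neither uses invariance of `T`.

Convergence: dominated convergence over `G` gives the limit `∫ ∑_i T(f_i g^* α) dg = ∫ T(g^* α) dg`,
which is `T(α)` precisely because `T` is invariant. To keep every sum finite, the operator with
parameter `ε` uses only those `f_i` whose supports meet the `⌊1/ε⌋`-th set of a compact exhaustion.
For small `ε` this includes every index that matters for `α`. -/

noncomputable section

namespace DeRham

set_option linter.unusedSectionVars false

/-! ### Differentiation under the integral sign -/

section ParametricSmoothness

universe u

variable {P : Type*} [TopologicalSpace P]
  {E : Type u} [NormedAddCommGroup E] [NormedSpace ℝ E]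
  {F : Type u} [NormedAddCommGroup F] [NormedSpace ℝ F]

/-- A family `H p`, `p ∈ P`, of functions that are smooth on `U`, all of whose derivatives are
jointly continuous in the parameter and the variable. -/
structure SmoothFamilyOn (H : P → E → F) (U : Set E) : Prop where
  contDiffOn : ∀ p, ContDiffOn ℝ ∞ (H p) U
  continuousOn : ∀ j : ℕ,
    ContinuousOn (fun q : P × E => iteratedFDeriv ℝ j (H q.1) q.2) (univ ×ˢ U)

/-- Up to a currying isometry the derivatives of `fderiv ℝ (H p)` are those of `H p` shifted by one.
This closure property drives the inductions on the order below; they replace `F` by `E →L[ℝ] F`,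
which is why `E` and `F` share a universe. -/
theorem SmoothFamilyOn.fderiv {H : P → E → F} {U : Set E} (hH : SmoothFamilyOn H U)
    (hU : IsOpen U) : SmoothFamilyOn (fun p => fderiv ℝ (H p)) U where
  contDiffOn p := (hH.contDiffOn p).fderiv_of_isOpen hU (by simp)
  continuousOn j := by
    have h := (continuousMultilinearCurryRightEquiv' ℝ j E F).continuous.comp_continuousOn
      (hH.continuousOn (j + 1))
    simp only [iteratedFDeriv_succ_eq_comp_right] at h
    exact h.congr fun q _ => by simp

theorem SmoothFamilyOn.hasFDerivAt {H : P → E → F} {U : Set E} (hH : SmoothFamilyOn H U)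
    (hU : IsOpen U) (p : P) {y : E} (hy : y ∈ U) :
    HasFDerivAt (H p) (_root_.fderiv ℝ (H p) y) y :=
  (((hH.contDiffOn p).contDiffAt (hU.mem_nhds hy)).differentiableAt (by simp)).hasFDerivAt

theorem SmoothFamilyOn.continuousOn_uncurry {H : P → E → F} {U : Set E}
    (hH : SmoothFamilyOn H U) : ContinuousOn (Function.uncurry H) (univ ×ˢ U) :=
  ((continuousMultilinearCurryFin0 ℝ E F).continuous.comp_continuousOn
    (hH.continuousOn 0)).congr fun q _ => by simp [Function.uncurry]

theorem SmoothFamilyOn.continuous_left {H : P → E → F} {U : Set E} (hH : SmoothFamilyOn H U)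
    {y : E} (hy : y ∈ U) : Continuous (fun p => H p y) := by
  rw [← continuousOn_univ]
  exact hH.continuousOn_uncurry.comp (f := fun p : P => (p, y)) (by fun_prop)
    fun p _ => ⟨mem_univ _, hy⟩

theorem SmoothFamilyOn.continuous_iteratedFDeriv_left {H : P → E → F} {U : Set E}
    (hH : SmoothFamilyOn H U) (j : ℕ) {y : E} (hy : y ∈ U) :
    Continuous (fun p => iteratedFDeriv ℝ j (H p) y) := by
  rw [← continuousOn_univ]
  exact (hH.continuousOn j).comp (f := fun p : P => (p, y)) (by fun_prop)
    fun p _ => ⟨mem_univ _, hy⟩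

section Integral

variable [MeasurableSpace P] [OpensMeasurableSpace P] [T2Space P] [ProperSpace E]
  [CompleteSpace F] (μ : Measure P) [IsFiniteMeasureOnCompacts μ]

/-- The dominating function is constant: the derivative is jointly continuous, hence bounded on the
compact product of `K` and a closed ball around `y`. -/
theorem SmoothFamilyOn.hasFDerivAt_integral {H : P → E → F} {U : Set E}
    (hH : SmoothFamilyOn H U) (hU : IsOpen U) {K : Set P} (hK : IsCompact K) {y : E}
    (hy : y ∈ U) :
    HasFDerivAt (fun y => ∫ p in K, H p y ∂μ) (∫ p in K, _root_.fderiv ℝ (H p) y ∂μ) y := by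
  obtain ⟨r, hr, hrU⟩ := Metric.nhds_basis_closedBall.mem_iff.1 (hU.mem_nhds hy)
  have hc : IsCompact (K ×ˢ Metric.closedBall y r) := hK.prod (isCompact_closedBall y r)
  obtain ⟨C, hC⟩ := hc.exists_bound_of_continuousOn
    ((hH.fderiv hU).continuousOn_uncurry.mono (prod_mono (subset_univ _) hrU))
  have : IsFiniteMeasure (μ.restrict K) := ⟨by
    rw [Measure.restrict_apply_univ]; exact hK.measure_lt_top⟩
  refine hasFDerivAt_integral_of_dominated_of_fderiv_le (𝕜 := ℝ) (E := F) (H := E)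
    (F := fun z p => H p z) (F' := fun z p => _root_.fderiv ℝ (H p) z) (bound := fun _ => C)
    (μ := μ.restrict K) (Metric.ball_mem_nhds y hr) ?_ ?_ ?_ ?_ (integrable_const C) ?_
  · filter_upwards [hU.mem_nhds hy] with z hz
    exact (hH.continuous_left hz).continuousOn.aestronglyMeasurable_of_isCompact hK
      hK.measurableSet
  · exact (hH.continuous_left hy).continuousOn.integrableOn_compact hK
  · exact ((hH.fderiv hU).continuous_left hy).continuousOn.aestronglyMeasurable_of_isCompact hK
      hK.measurableSet
  · exact (ae_restrict_iff' hK.measurableSet).2 (Eventually.of_forall fun p hp z hz =>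
      hC (p, z) ⟨hp, Metric.ball_subset_closedBall hz⟩)
  · exact Eventually.of_forall fun p z hz =>
      hH.hasFDerivAt hU p (hrU (Metric.ball_subset_closedBall hz))

theorem SmoothFamilyOn.contDiffOn_integral {H : P → E → F} {U : Set E}
    (hH : SmoothFamilyOn H U) (hU : IsOpen U) {K : Set P} (hK : IsCompact K) :
    ContDiffOn ℝ ∞ (fun y => ∫ p in K, H p y ∂μ) U := by
  rw [contDiffOn_infty]
  intro r
  induction r generalizing F with
  | zero =>
    exact contDiffOn_zero.2 fun y hy =>
      (hH.hasFDerivAt_integral μ hU hK hy).continuousAt.continuousWithinAt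
  | succ r ih =>
    push_cast
    refine (contDiffOn_succ_iff_fderiv_of_isOpen hU).2
      ⟨fun y hy => (hH.hasFDerivAt_integral μ hU hK hy).differentiableAt.differentiableWithinAt,
        by simp, (ih (hH.fderiv hU)).congr fun y hy =>
          (hH.hasFDerivAt_integral μ hU hK hy).fderiv⟩

theorem SmoothFamilyOn.iteratedFDeriv_integral {H : P → E → F} {U : Set E}
    (hH : SmoothFamilyOn H U) (hU : IsOpen U) {K : Set P} (hK : IsCompact K) (j : ℕ) {y : E}
    (hy : y ∈ U) :
    iteratedFDeriv ℝ j (fun y => ∫ p in K, H p y ∂μ) y =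
      ∫ p in K, iteratedFDeriv ℝ j (H p) y ∂μ := by
  induction j generalizing F with
  | zero =>
    ext v
    rw [ContinuousMultilinearMap.integral_apply]
    · simp
    · exact (hH.continuous_iteratedFDeriv_left 0 hy).continuousOn.integrableOn_compact hK
  | succ j ih =>
    have h1 : _root_.fderiv ℝ (fun y => ∫ p in K, H p y ∂μ) =ᶠ[𝓝 y]
        fun y => ∫ p in K, _root_.fderiv ℝ (H p) y ∂μ := by
      filter_upwards [hU.mem_nhds hy] with z hz using (hH.hasFDerivAt_integral μ hU hK hz).fderiv
    have hi := ((hH.fderiv hU).continuous_iteratedFDeriv_left j hy).continuousOn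
      |>.integrableOn_compact (μ := μ) hK
    ext v
    rw [ContinuousMultilinearMap.integral_apply
      ((hH.continuous_iteratedFDeriv_left (j + 1) hy).continuousOn.integrableOn_compact hK)]
    simp only [iteratedFDeriv_succ_apply_right]
    rw [(h1.iteratedFDeriv ℝ j).eq_of_nhds, ih (hH.fderiv hU),
      ContinuousMultilinearMap.integral_apply hi, ContinuousLinearMap.integral_apply]
    exact (ContinuousMultilinearMap.apply ℝ (fun _ : Fin j => E) (E →L[ℝ] F)
      (Fin.init v)).integrable_comp hi

end Integral

end ParametricSmoothness

/-! ### Jointly smooth maps are smooth families -/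

section JointSmoothness

universe u

variable {V : Type*} [NormedAddCommGroup V] [NormedSpace ℝ V] {B : Type*} [TopologicalSpace B]
  {I : ModelWithCorners ℝ V B} {P : Type*} [TopologicalSpace P] [ChartedSpace B P]
  [IsManifold I ∞ P]
  {E : Type*} [NormedAddCommGroup E] [NormedSpace ℝ E]
  {F : Type*} [NormedAddCommGroup F] [NormedSpace ℝ F]

/-- The derivative in the second variable alone is smooth in both. The pair `q` serves as the
parameter of the manifold derivative, taken at the point `q.2`; between vector spaces the tangent
coordinates are trivial. -/
theorem contMDiffAt_fderiv_right {H : P → E → F} {q : P × E}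
    (hH : ContMDiffAt (I.prod 𝓘(ℝ, E)) 𝓘(ℝ, F) ∞ (Function.uncurry H) q) :
    ContMDiffAt (I.prod 𝓘(ℝ, E)) 𝓘(ℝ, E →L[ℝ] F) ∞
      (fun q : P × E => fderiv ℝ (H q.1) q.2) q := by
  have h := ContMDiffAt.mfderiv (J := I.prod 𝓘(ℝ, E)) (I := 𝓘(ℝ, E)) (I' := 𝓘(ℝ, F)) (x₀ := q)
    (m := ∞) (n := ∞) (fun (q : P × E) (y : E) => H q.1 y) Prod.snd ?_ contMDiffAt_snd (by simp)
  · simpa only [inTangentCoordinates_model_space, mfderiv_eq_fderiv] using h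
  · have h2 : ContMDiffAt ((I.prod 𝓘(ℝ, E)).prod 𝓘(ℝ, E)) (I.prod 𝓘(ℝ, E)) ∞
        (fun w : (P × E) × E => (w.1.1, w.2)) (q, q.2) :=
      (contMDiffAt_fst.fst).prodMk contMDiffAt_snd
    exact ContMDiffAt.comp (q, q.2) (g := Function.uncurry H) hH h2

theorem contMDiffOn_fderiv_right {H : P → E → F} {O : Set (P × E)} (hO : IsOpen O)
    (hH : ContMDiffOn (I.prod 𝓘(ℝ, E)) 𝓘(ℝ, F) ∞ (Function.uncurry H) O) :
    ContMDiffOn (I.prod 𝓘(ℝ, E)) 𝓘(ℝ, E →L[ℝ] F) ∞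
      (fun q : P × E => fderiv ℝ (H q.1) q.2) O := fun _ hq =>
  (contMDiffAt_fderiv_right (hH.contMDiffAt (hO.mem_nhds hq))).contMDiffWithinAt

theorem continuousOn_iteratedFDeriv_right {E F : Type u} [NormedAddCommGroup E]
    [NormedSpace ℝ E] [NormedAddCommGroup F] [NormedSpace ℝ F] {H : P → E → F} {O : Set (P × E)}
    (hO : IsOpen O)
    (hH : ContMDiffOn (I.prod 𝓘(ℝ, E)) 𝓘(ℝ, F) ∞ (Function.uncurry H) O) (j : ℕ) :
    ContinuousOn (fun q : P × E => iteratedFDeriv ℝ j (H q.1) q.2) O := by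
  induction j generalizing F with
  | zero =>
    exact (continuousMultilinearCurryFin0 ℝ E F).symm.continuous.comp_continuousOn hH.continuousOn
  | succ j ih =>
    have h := ih (H := fun p => fderiv ℝ (H p)) (contMDiffOn_fderiv_right hO hH)
    simp only [iteratedFDeriv_succ_eq_comp_right]
    exact (LinearIsometryEquiv.continuous _).comp_continuousOn h

theorem contDiffAt_of_contMDiffAt_prod {H : P → E → F} {q : P × E}
    (hH : ContMDiffAt (I.prod 𝓘(ℝ, E)) 𝓘(ℝ, F) ∞ (Function.uncurry H) q) :
    ContDiffAt ℝ ∞ (H q.1) q.2 :=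
  (ContMDiffAt.comp q.2 (g := Function.uncurry H) (f := fun y => (q.1, y)) hH
    (contMDiffAt_const.prodMk contMDiffAt_id)).contDiffAt

theorem smoothFamilyOn_of_contMDiffOn {E F : Type u} [NormedAddCommGroup E]
    [NormedSpace ℝ E] [NormedAddCommGroup F] [NormedSpace ℝ F] {H : P → E → F}
    {U : Set E} (hU : IsOpen U)
    (hH : ContMDiffOn (I.prod 𝓘(ℝ, E)) 𝓘(ℝ, F) ∞ (Function.uncurry H) (univ ×ˢ U)) :
    SmoothFamilyOn H U where
  contDiffOn p y hy := (contDiffAt_of_contMDiffAt_prod (q := (p, y))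
    (hH.contMDiffAt ((isOpen_univ.prod hU).mem_nhds ⟨mem_univ _, hy⟩))).contDiffWithinAt
  continuousOn j := continuousOn_iteratedFDeriv_right (isOpen_univ.prod hU) hH j

/-- Jointly smooth functions on a product of normed spaces are smooth families. -/
theorem smoothFamilyOn_of_contDiff {E F : Type u} [NormedAddCommGroup E]
    [NormedSpace ℝ E] [NormedAddCommGroup F] [NormedSpace ℝ F] {Q : Type*}
    [NormedAddCommGroup Q] [NormedSpace ℝ Q]
    {H : Q → E → F} (hH : ContDiff ℝ ∞ (Function.uncurry H)) : SmoothFamilyOn H univ := by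
  refine smoothFamilyOn_of_contMDiffOn (I := 𝓘(ℝ, Q)) isOpen_univ ?_
  rw [← modelWithCornersSelf_prod]
  have := hH.contMDiff.contMDiffOn (s := univ ×ˢ (univ : Set E))
  rwa [chartedSpaceSelf_prod]

end JointSmoothness

/-! ### Smooth dependence of translates in the sup norm -/

section Translation

universe u

/-- The family of restrictions to the compact set `L` of the translates of a continuous
function. -/
def translates {E F : Type*} [NormedAddCommGroup E] [NormedAddCommGroup F] (L : Set E)
    (ψ : C(E, F)) (z : E) : C(L, F) := ⟨fun x => ψ (x - z), by fun_prop⟩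

theorem continuous_translates {E F : Type*} [NormedAddCommGroup E] [NormedAddCommGroup F]
    (L : Set E) (ψ : C(E, F)) : Continuous (translates L ψ) := by
  refine ContinuousMap.continuous_of_continuous_uncurry _ ?_
  change Continuous fun p : E × L => ψ (p.2 - p.1)
  fun_prop

/-- Evaluation turns a continuous function with values in continuous linear maps into a continuous
linear map with values in continuous functions. -/
def flipContinuousMap {E F X : Type*} [NormedAddCommGroup E] [NormedSpace ℝ E]
    [NormedAddCommGroup F] [NormedSpace ℝ F] [TopologicalSpace X] [CompactSpace X] :
    C(X, E →L[ℝ] F) →L[ℝ] (E →L[ℝ] C(X, F)) :=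
  LinearMap.mkContinuous₂
    (LinearMap.mk₂ ℝ (fun (f : C(X, E →L[ℝ] F)) (v : E) =>
        (⟨fun x => f x v, by fun_prop⟩ : C(X, F)))
      (fun f g v => by ext x; simp) (fun c f v => by ext x; simp)
      (fun f v w => by ext x; simp) (fun c f v => by ext x; simp)) 1 fun f v => by
    rw [one_mul, ContinuousMap.norm_le _ (by positivity)]
    intro x
    exact ((f x).le_opNorm v).trans (by gcongr; exact f.norm_coe_le_norm x)

theorem flipContinuousMap_apply {E F X : Type*} [NormedAddCommGroup E] [NormedSpace ℝ E]
    [NormedAddCommGroup F] [NormedSpace ℝ F] [TopologicalSpace X] [CompactSpace X]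
    (f : C(X, E →L[ℝ] F)) (v : E) (x : X) : flipContinuousMap f v x = f x v := rfl

/-- The mean value inequality is applied for each `x ∈ L` separately, with one `δ` for all `x`: the
translates of `fderiv ℝ ψ` vary continuously in the sup norm. -/
theorem hasFDerivAt_translates {E F : Type*} [NormedAddCommGroup E] [NormedSpace ℝ E]
    [NormedAddCommGroup F] [NormedSpace ℝ F] (L : Set E) [CompactSpace L] {ψ : C(E, F)}
    (hψ : Differentiable ℝ ψ) (hψ' : Continuous (fderiv ℝ ψ)) (z : E) :
    HasFDerivAt (translates L ψ) (-flipContinuousMap (translates L ⟨fderiv ℝ ψ, hψ'⟩ z)) z := by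
  rw [hasFDerivAt_iff_isLittleO, Asymptotics.isLittleO_iff]
  intro c hc
  have h := Metric.continuousAt_iff.1
    ((continuous_translates L ⟨fderiv ℝ ψ, hψ'⟩).continuousAt (x := z)) c hc
  obtain ⟨δ, hδ, h⟩ := h
  filter_upwards [Metric.ball_mem_nhds z hδ] with z' hz'
  rw [ContinuousMap.norm_le _ (by positivity)]
  intro x
  have hd : ∀ w ∈ Metric.ball z δ, HasFDerivWithinAt (fun w => ψ (x - w))
      (-(fderiv ℝ ψ (x - w))) (Metric.ball z δ) w := fun w _ => by
    have h1 : HasFDerivAt (fun w : E => (x : E) - w) (-ContinuousLinearMap.id ℝ E) w :=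
      (hasFDerivAt_id w).const_sub _
    have h2 := (hψ (x - w)).hasFDerivAt.comp w h1
    refine HasFDerivAt.hasFDerivWithinAt ?_
    rw [ContinuousLinearMap.comp_neg, ContinuousLinearMap.comp_id] at h2
    exact h2
  have hb : ∀ w ∈ Metric.ball z δ, ‖-(fderiv ℝ ψ (x - w)) - -(fderiv ℝ ψ (x - z))‖ ≤ c := by
    intro w hw
    have h3 := (ContinuousMap.dist_apply_le_dist x).trans (h hw).le
    rw [← neg_sub_neg, neg_neg, neg_neg, ← neg_sub, norm_neg, ← dist_eq_norm, dist_comm]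
    rw [dist_comm] at h3
    simpa [translates, dist_comm] using h3
  have := Convex.norm_image_sub_le_of_norm_hasFDerivWithin_le' hd hb (convex_ball z δ)
    (Metric.mem_ball_self hδ) hz'
  simpa [translates, flipContinuousMap_apply] using this

/-- The derivative of the translates of `ψ` is a fixed continuous linear map applied to the
translates of `fderiv ℝ ψ`, so induction on the order applies. -/
theorem contDiff_translates {E F : Type u} [NormedAddCommGroup E] [NormedSpace ℝ E]
    [NormedAddCommGroup F] [NormedSpace ℝ F] (L : Set E) [CompactSpace L] {ψ : C(E, F)}
    (hψ : ContDiff ℝ ∞ ψ) : ContDiff ℝ ∞ (translates L ψ) := by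
  rw [contDiff_infty]
  intro r
  induction r generalizing F with
  | zero => exact contDiff_zero.2 (continuous_translates L ψ)
  | succ r ih =>
    have hψ' : ContDiff ℝ ∞ (fderiv ℝ ψ) := hψ.fderiv_right (by simp)
    refine contDiff_succ_iff_hasFDerivAt.2 ⟨_, ?_,
      hasFDerivAt_translates L (hψ.differentiable (by simp)) hψ'.continuous⟩
    exact ((flipContinuousMap (E := E) (F := F) (X := L)).contDiff.comp
      (ih (ψ := ⟨fderiv ℝ ψ, hψ'.continuous⟩) hψ')).neg

end Translation

/-! ### Jets and their convolution with a mollifier -/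

section Jets

variable {E : Type} [NormedAddCommGroup E] [NormedSpace ℝ E]
  {F : Type} [NormedAddCommGroup F] [NormedSpace ℝ F]

variable (E F) in
/-- The space of `r`-jets at a point of functions from `E` to `F`. -/
abbrev Jet (r : ℕ) : Type :=
  ∀ j : Fin (r + 1), ContinuousMultilinearMap ℝ (fun _ : Fin (j : ℕ) => E) F

/-- The `r`-jet of `u`. -/
def jet (r : ℕ) (u : E → F) (x : E) : Jet E F r := fun j => iteratedFDeriv ℝ j u x

theorem contDiff_jet (r : ℕ) {u : E → F} (hu : ContDiff ℝ ∞ u) : ContDiff ℝ ∞ (jet r u) :=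
  contDiff_pi.2 fun j => hu.iteratedFDeriv_right (m := ∞) (i := j) (by exact_mod_cast le_top)

theorem jet_comp_sub (r : ℕ) (u : E → F) (z x : E) :
    jet r (fun x => u (x - z)) x = jet r u (x - z) :=
  funext fun j => iteratedFDeriv_comp_sub (j : ℕ) z x

theorem jet_add (r : ℕ) {u v : E → F} (hu : ContDiff ℝ ∞ u) (hv : ContDiff ℝ ∞ v) (x : E) :
    jet r (u + v) x = jet r u x + jet r v x :=
  funext fun j => iteratedFDeriv_add_apply (hu.contDiffAt.of_le (by exact_mod_cast le_top))
    (hv.contDiffAt.of_le (by exact_mod_cast le_top))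

theorem jet_const_smul (r : ℕ) (c : ℝ) {u : E → F} (hu : ContDiff ℝ ∞ u) (x : E) :
    jet r (c • u) x = c • jet r u x :=
  funext fun j => iteratedFDeriv_const_smul_apply (hu.contDiffAt.of_le (by exact_mod_cast le_top))

theorem jet_eq_zero (r : ℕ) {u : E → F} {x : E} (hx : x ∉ tsupport u) : jet r u x = 0 :=
  funext fun j => image_eq_zero_of_notMem_tsupport fun h =>
    hx (tsupport_iteratedFDeriv_subset (j : ℕ) h)

theorem hasCompactSupport_jet (r : ℕ) {u : E → F} (hu : HasCompactSupport u) :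
    HasCompactSupport (jet r u) :=
  HasCompactSupport.intro hu fun _ hx => jet_eq_zero r hx

/-- Convolving with `φ` commutes with taking jets. -/
theorem integral_jet_smul [FiniteDimensional ℝ E] [MeasurableSpace E] [BorelSpace E]
    (μ : Measure E) [μ.IsAddHaarMeasure] [CompleteSpace F] (r : ℕ) {φ : E → ℝ}
    (hφ : ContDiff ℝ ∞ φ) (hφc : HasCompactSupport φ) {v : E → F} (hv : ContDiff ℝ ∞ v)
    (hvc : HasCompactSupport v) (x : E) :
    ∫ z, jet r (fun x => φ (x - z) • v z) x ∂μ = ∫ z, φ z • jet r v (x - z) ∂μ := by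
  have : ProperSpace E := FiniteDimensional.proper ℝ E
  have h1 : SmoothFamilyOn (fun z x => φ (x - z) • v z) univ :=
    smoothFamilyOn_of_contDiff ((hφ.comp (contDiff_snd.sub contDiff_fst)).smul
      (hv.comp contDiff_fst))
  have h2 : SmoothFamilyOn (fun z x => φ z • v (x - z)) univ :=
    smoothFamilyOn_of_contDiff ((hφ.comp contDiff_fst).smul
      (hv.comp (contDiff_snd.sub contDiff_fst)))
  have hcont1 : Continuous fun z => jet r (fun x => φ (x - z) • v z) x :=
    continuous_pi fun j => h1.continuous_iteratedFDeriv_left j (mem_univ x)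
  have hi1 : Integrable (fun z => jet r (fun x => φ (x - z) • v z) x) μ := by
    refine hcont1.integrable_of_hasCompactSupport (HasCompactSupport.intro hvc fun z hz => ?_)
    rw [image_eq_zero_of_notMem_tsupport hz]
    simp only [smul_zero]
    exact jet_eq_zero r (by simp [tsupport])
  have hi2 : Integrable (fun z => φ z • jet r v (x - z)) μ := by
    refine Continuous.integrable_of_hasCompactSupport ?_ hφc.smul_right
    exact hφ.continuous.smul ((contDiff_jet r hv).continuous.comp (by fun_prop))
  funext j
  rw [eval_integral fun i => hi1.eval i, eval_integral fun i => hi2.eval i]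
  -- The substitution `z ↦ y - z` moves the translation from `φ` to `v`. Both integrals are over
  -- compact sets, so each side can be differentiated under the integral.
  have e1 : (fun x => ∫ z in tsupport v, φ (x - z) • v z ∂μ) =
      fun x => ∫ z in tsupport φ, φ z • v (x - z) ∂μ := by
    funext y
    rw [setIntegral_eq_integral_of_forall_compl_eq_zero fun z hz => by
        rw [image_eq_zero_of_notMem_tsupport hz, smul_zero],
      setIntegral_eq_integral_of_forall_compl_eq_zero fun z hz => by
        rw [image_eq_zero_of_notMem_tsupport hz, zero_smul],
      ← integral_sub_left_eq_self (fun z => φ (y - z) • v z) μ y]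
    simp
  have e2 := h1.iteratedFDeriv_integral μ isOpen_univ hvc (j : ℕ) (mem_univ x)
  have e3 := h2.iteratedFDeriv_integral μ isOpen_univ hφc (j : ℕ) (mem_univ x)
  rw [e1, e3, setIntegral_eq_integral_of_forall_compl_eq_zero,
    setIntegral_eq_integral_of_forall_compl_eq_zero] at e2
  · refine e2.symm.trans (integral_congr_ae (Eventually.of_forall fun z => ?_))
    change iteratedFDeriv ℝ (j : ℕ) (φ z • fun x => v (x - z)) x =
      φ z • iteratedFDeriv ℝ j v (x - z)
    rw [iteratedFDeriv_const_smul_apply, iteratedFDeriv_comp_sub]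
    exact ((hv.comp (contDiff_id.sub contDiff_const)).contDiffAt.of_le (by exact_mod_cast le_top))
  · intro z hz
    rw [image_eq_zero_of_notMem_tsupport hz]
    simp only [smul_zero]
    exact congrFun (iteratedFDeriv_fun_zero) x
  · intro z hz
    rw [image_eq_zero_of_notMem_tsupport hz]
    simp only [zero_smul]
    exact congrFun (iteratedFDeriv_fun_zero) x

end Jets

/-! ### Uniform approximation by mollification -/

section Mollifier

variable {E : Type*} [NormedAddCommGroup E] [NormedSpace ℝ E] [FiniteDimensional ℝ E]
  [MeasurableSpace E] [BorelSpace E] (μ : Measure E) [μ.IsAddHaarMeasure]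
  {F : Type*} [NormedAddCommGroup F] [NormedSpace ℝ F] [CompleteSpace F]

theorem norm_integral_normed_smul_le (φ : ContDiffBump (0 : E)) {w : E → F} {C : ℝ}
    (hw : ∀ x, ‖w x‖ ≤ C) (x : E) : ‖∫ z, φ.normed μ z • w (x - z) ∂μ‖ ≤ C := by
  calc ‖∫ z, φ.normed μ z • w (x - z) ∂μ‖ ≤ ∫ z, φ.normed μ z * C ∂μ := by
        refine norm_integral_le_of_norm_le (φ.integrable_normed.mul_const C)
          (Eventually.of_forall fun z => ?_)
        rw [norm_smul, Real.norm_of_nonneg (φ.nonneg_normed z)]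
        exact mul_le_mul_of_nonneg_left (hw _) (φ.nonneg_normed z)
    _ = C := by rw [integral_mul_const, φ.integral_normed, one_mul]

theorem eventually_norm_integral_normed_smul_sub_le {ι : Type*} {l : Filter ι}
    {φ : ι → ContDiffBump (0 : E)} (hφ : Tendsto (fun i => (φ i).rOut) l (𝓝 0)) {w : E → F}
    (hw : Continuous w) (hwc : HasCompactSupport w) {c : ℝ} (hc : 0 < c) :
    ∀ᶠ i in l, ∀ x, ‖∫ z, (φ i).normed μ z • w (x - z) ∂μ - w x‖ ≤ c := by
  obtain ⟨δ, hδ, h⟩ := Metric.uniformContinuous_iff.1 (hwc.uniformContinuous_of_continuous hw) c hc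
  filter_upwards [hφ.eventually (gt_mem_nhds hδ)] with i hi x
  rw [← dist_eq_norm]
  exact ContDiffBump.dist_normed_convolution_le hw.aestronglyMeasurable fun y hy =>
    (h ((Metric.mem_ball.1 hy).trans hi)).le

end Mollifier

/-! ### Smooth extension by zero -/

section ExtendByZero

variable {E : Type*} [NormedAddCommGroup E] [NormedSpace ℝ E]
  {F : Type*} [NormedAddCommGroup F] [NormedSpace ℝ F]

theorem contDiff_of_contDiffOn_of_tsupport_subset {w : E → F} {U : Set E} (hU : IsOpen U)
    (hw : ContDiffOn ℝ ∞ w U) (hs : tsupport w ⊆ U) : ContDiff ℝ ∞ w :=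
  contMDiff_iff_contDiff.1 <| contMDiff_of_tsupport fun _ hx =>
    (hw.contDiffAt (hU.mem_nhds (hs hx))).contMDiffAt

theorem contDiff_smul_of_tsupport_subset {ρ : E → ℝ} {w : E → F} {U : Set E} (hU : IsOpen U)
    (hρ : ContDiff ℝ ∞ ρ) (hs : tsupport ρ ⊆ U) (hw : ContDiffOn ℝ ∞ w U) :
    ContDiff ℝ ∞ (fun x => ρ x • w x) :=
  contDiff_of_contDiffOn_of_tsupport_subset hU (hρ.contDiffOn.smul hw)
    ((tsupport_smul_subset_left ρ w).trans hs)

end ExtendByZero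

/-- Finite dimension makes linear functionals on alternating forms continuous, and lets smoothness
of operator-valued maps be tested on each argument. -/
instance finiteDimensional_alternating (n m : ℕ) :
    FiniteDimensional ℝ (EuclideanSpace ℝ (Fin n) [⋀^Fin m]→L[ℝ] ℝ) := by
  have : FiniteDimensional ℝ
      (ContinuousMultilinearMap ℝ (fun _ : Fin m => EuclideanSpace ℝ (Fin n)) ℝ) :=
    Module.Finite.of_injective
      (ContinuousMultilinearMap.toMultilinearMapLinear :
        ContinuousMultilinearMap ℝ (fun _ : Fin m => EuclideanSpace ℝ (Fin n)) ℝ →ₗ[ℝ]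
          MultilinearMap ℝ (fun _ : Fin m => EuclideanSpace ℝ (Fin n)) ℝ)
      ContinuousMultilinearMap.toMultilinearMap_injective
  let J : (EuclideanSpace ℝ (Fin n) [⋀^Fin m]→L[ℝ] ℝ) →L[ℝ]
      ContinuousMultilinearMap ℝ (fun _ : Fin m => EuclideanSpace ℝ (Fin n)) ℝ :=
    ContinuousAlternatingMap.toContinuousMultilinearMapCLM ℝ
  exact Module.Finite.of_injective
    (J : (EuclideanSpace ℝ (Fin n) [⋀^Fin m]→L[ℝ] ℝ) →ₗ[ℝ]
      ContinuousMultilinearMap ℝ (fun _ : Fin m => EuclideanSpace ℝ (Fin n)) ℝ)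
    fun _ _ h => ContinuousAlternatingMap.toContinuousMultilinearMap_injective h

/-- The model space `ℝⁿ`. -/
abbrev Euc (n : ℕ) : Type := EuclideanSpace ℝ (Fin n)

/-- The alternating `m`-linear forms on `ℝⁿ`. -/
abbrev Alt (n m : ℕ) : Type := Euc n [⋀^Fin m]→L[ℝ] ℝ

/-! ### Forms in charts and transport of forms from a chart to the manifold -/

section Charts

variable {n m : ℕ} {M : Type*} [TopologicalSpace M] [ChartedSpace (EuclideanSpace ℝ (Fin n)) M]

theorem apply_congr_point (α : FormField n M m) {p q : M} {v w : Fin m → Euc n} (hpq : p = q)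
    (hvw : v = w) : (α p : (Fin m → Euc n) → ℝ) v = (α q : (Fin m → Euc n) → ℝ) w := by
  subst hpq hvw
  rfl

variable [IsManifold (𝓡 n) ∞ M]
  {e e' : OpenPartialHomeomorph M (Euc n)}

theorem contMDiffAt_symm_of_mem (he : e ∈ IsManifold.maximalAtlas (𝓡 n) ∞ M) {y : Euc n}
    (hy : y ∈ e.target) : ContMDiffAt (𝓡 n) (𝓡 n) ∞ e.symm y :=
  (contMDiffOn_symm_of_mem_maximalAtlas he).contMDiffAt (e.open_target.mem_nhds hy)

theorem contMDiffAt_of_mem (he : e ∈ IsManifold.maximalAtlas (𝓡 n) ∞ M) {x : M}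
    (hx : x ∈ e.source) : ContMDiffAt (𝓡 n) (𝓡 n) ∞ e x :=
  (contMDiffOn_of_mem_maximalAtlas he).contMDiffAt (e.open_source.mem_nhds hx)

/-- The expression of a pullback in charts. -/
theorem chartRep_pullbackField {f : M → M} (hf : ContMDiff (𝓡 n) (𝓡 n) ∞ f)
    (he : e ∈ IsManifold.maximalAtlas (𝓡 n) ∞ M) (he' : e' ∈ IsManifold.maximalAtlas (𝓡 n) ∞ M)
    (α : FormField n M m) {y : Euc n} (hy : y ∈ e.target) (hy' : f (e.symm y) ∈ e'.source) :
    chartRep e (pullbackField f α) y =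
      (chartRep e' α (e' (f (e.symm y)))).compContinuousLinearMap
        (fderiv ℝ (fun y => e' (f (e.symm y))) y) := by
  have hne : (∞ : ℕ∞ω) ≠ 0 := by simp
  have hes := contMDiffAt_symm_of_mem he hy
  have hfe : ContMDiffAt (𝓡 n) (𝓡 n) ∞ (fun y => f (e.symm y)) y := hf.contMDiffAt.comp y hes
  have hg : ContMDiffAt (𝓡 n) (𝓡 n) ∞ (fun y => e' (f (e.symm y))) y :=
    (contMDiffAt_of_mem he' hy').comp y hfe
  have hpt : e'.symm (e' (f (e.symm y))) = f (e.symm y) := e'.left_inv hy'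
  have h1 : mfderiv (𝓡 n) (𝓡 n) (fun y => f (e.symm y)) y =
      (mfderiv (𝓡 n) (𝓡 n) f (e.symm y)).comp (mfderiv (𝓡 n) (𝓡 n) e.symm y) :=
    mfderiv_comp y (hf.contMDiffAt.mdifferentiableAt hne) (hes.mdifferentiableAt hne)
  have h2 : mfderiv (𝓡 n) (𝓡 n) (fun y => e'.symm (e' (f (e.symm y)))) y =
      (mfderiv (𝓡 n) (𝓡 n) e'.symm (e' (f (e.symm y)))).comp
        (mfderiv (𝓡 n) (𝓡 n) (fun y => e' (f (e.symm y))) y) :=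
    mfderiv_comp y ((contMDiffAt_symm_of_mem he' (e'.map_source hy')).mdifferentiableAt hne)
      (hg.mdifferentiableAt hne)
  have h3 : (fun y => e'.symm (e' (f (e.symm y)))) =ᶠ[𝓝 y] fun y => f (e.symm y) := by
    filter_upwards [hfe.continuousAt.preimage_mem_nhds (e'.open_source.mem_nhds hy')] with z hz
    exact e'.left_inv hz
  ext v
  refine apply_congr_point α hpt.symm (funext fun i => ?_)
  have h5 := (h1.symm.trans (h3.mfderiv_eq (I := 𝓡 n) (I' := 𝓡 n)).symm).trans h2
  rw [mfderiv_eq_fderiv] at h5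
  exact DFunLike.congr_fun h5 (v i)

theorem pullbackField_id (α : FormField n M m) : pullbackField id α = α := by
  funext x
  ext v
  simp [pullbackField]

/-- The change of charts formula for differential forms. -/
theorem chartRep_eq_of_mem (he : e ∈ IsManifold.maximalAtlas (𝓡 n) ∞ M)
    (he' : e' ∈ IsManifold.maximalAtlas (𝓡 n) ∞ M)
    (α : FormField n M m) {y : Euc n} (hy : y ∈ e.target) (hy' : e.symm y ∈ e'.source) :
    chartRep e α y = (chartRep e' α (e' (e.symm y))).compContinuousLinearMap
        (fderiv ℝ (fun y => e' (e.symm y)) y) := by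
  have h := chartRep_pullbackField contMDiff_id he he' α hy hy'
  rw [pullbackField_id] at h
  exact h

theorem isOpen_overlap (e e' : OpenPartialHomeomorph M (Euc n)) :
    IsOpen (e.target ∩ e.symm ⁻¹' e'.source) :=
  e.symm.isOpen_inter_preimage e'.open_source

theorem contDiffOn_transition (he : e ∈ IsManifold.maximalAtlas (𝓡 n) ∞ M)
    (he' : e' ∈ IsManifold.maximalAtlas (𝓡 n) ∞ M) :
    ContDiffOn ℝ ∞ (fun y => e' (e.symm y)) (e.target ∩ e.symm ⁻¹' e'.source) := fun y hy =>
  ((contMDiffAt_of_mem he' hy.2).comp y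
    (contMDiffAt_symm_of_mem he hy.1)).contDiffAt.contDiffWithinAt

open Classical in
/-- The form on `M` which vanishes outside the domain of the chart `e` and whose expression in
this chart is `u`. -/
def formOf (e : OpenPartialHomeomorph M (Euc n)) (u : Euc n → Alt n m) : FormField n M m :=
  fun x => if x ∈ e.source then
    (u (e x)).compContinuousLinearMap
      (mfderiv (𝓡 n) (𝓡 n) e x : TangentSpace (𝓡 n) x →L[ℝ] Euc n) else 0

theorem formOf_of_mem {u : Euc n → Alt n m} {x : M} (hx : x ∈ e.source) :
    formOf e u x = (u (e x)).compContinuousLinearMap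
      (mfderiv (𝓡 n) (𝓡 n) e x : TangentSpace (𝓡 n) x →L[ℝ] Euc n) := if_pos hx

theorem formOf_of_notMem {u : Euc n → Alt n m} {x : M} (hx : x ∉ e.source) :
    formOf e u x = 0 := if_neg hx

theorem chartRep_formOf (he : e ∈ IsManifold.maximalAtlas (𝓡 n) ∞ M) (u : Euc n → Alt n m)
    {y : Euc n} (hy : y ∈ e.target) : chartRep e (formOf e u) y = u y := by
  have hne : (∞ : ℕ∞ω) ≠ 0 := by simp
  have hx : e.symm y ∈ e.source := e.map_target hy
  have h1 : mfderiv (𝓡 n) (𝓡 n) (fun y => e (e.symm y)) y =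
      (mfderiv (𝓡 n) (𝓡 n) e (e.symm y)).comp (mfderiv (𝓡 n) (𝓡 n) e.symm y) :=
    mfderiv_comp y ((contMDiffAt_of_mem he hx).mdifferentiableAt hne)
      ((contMDiffAt_symm_of_mem he hy).mdifferentiableAt hne)
  have h2 : (fun y => e (e.symm y)) =ᶠ[𝓝 y] id := by
    filter_upwards [e.open_target.mem_nhds hy] with z hz using e.right_inv hz
  have h3 := h1.symm.trans (h2.mfderiv_eq (I := 𝓡 n) (I' := 𝓡 n))
  rw [mfderiv_id] at h3
  rw [chartRep, formOf_of_mem hx]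
  ext v
  change u (e (e.symm y)) _ = u y v
  rw [e.right_inv hy]
  congr 1
  funext i
  exact DFunLike.congr_fun h3 (v i)

/-- The chain rule for `e.symm ∘ e = id` near `x`. It shows that cutting off in the chart is
multiplication by `ρ ∘ e` on the manifold, so a partition of unity reassembles `β`. -/
theorem formOf_chartRep (he : e ∈ IsManifold.maximalAtlas (𝓡 n) ∞ M) (ρ : Euc n → ℝ)
    (β : FormField n M m) {x : M} (hx : x ∈ e.source) :
    formOf e (fun y => ρ y • chartRep e β y) x = ρ (e x) • β x := by
  have hne : (∞ : ℕ∞ω) ≠ 0 := by simp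
  have h1 : mfderiv (𝓡 n) (𝓡 n) (fun x => e.symm (e x)) x =
      (mfderiv (𝓡 n) (𝓡 n) e.symm (e x)).comp (mfderiv (𝓡 n) (𝓡 n) e x) :=
    mfderiv_comp x ((contMDiffAt_symm_of_mem he (e.map_source hx)).mdifferentiableAt hne)
      ((contMDiffAt_of_mem he hx).mdifferentiableAt hne)
  have h2 : (fun x => e.symm (e x)) =ᶠ[𝓝 x] id := by
    filter_upwards [e.open_source.mem_nhds hx] with z hz using e.left_inv hz
  have h3 := h1.symm.trans (h2.mfderiv_eq (I := 𝓡 n) (I' := 𝓡 n))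
  rw [mfderiv_id] at h3
  rw [formOf_of_mem hx]
  ext v
  refine congrArg (ρ (e x) * ·) (apply_congr_point β (e.left_inv hx) (funext fun i => ?_))
  exact DFunLike.congr_fun h3 (v i)

theorem chartRep_eq_zero {α : FormField n M m} {y : Euc n} (h : α (e.symm y) = 0) :
    chartRep e α y = 0 := by
  rw [chartRep, h]
  ext v
  rfl

theorem notMem_formSupport {α : FormField n M m} {x : M} (h : x ∉ formSupport α) : α x = 0 := by
  by_contra h'
  exact h (subset_closure h')

theorem formOf_eq_zero {L : Set (Euc n)} {u : Euc n → Alt n m} (hu : ∀ y ∉ L, u y = 0)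
    {x : M} (hx : x ∉ e.symm '' L) : formOf e u x = 0 := by
  by_cases h : x ∈ e.source
  · rw [formOf_of_mem h, hu (e x) fun h' => hx ⟨e x, h', e.left_inv h⟩]
    ext v
    rfl
  · exact formOf_of_notMem h

theorem isCompact_symm_image {L : Set (Euc n)} (hL : IsCompact L) (hLe : L ⊆ e.target) :
    IsCompact (e.symm '' L) :=
  hL.image_of_continuousOn (e.continuousOn_symm.mono hLe)

variable [T2Space M]

theorem formSupport_formOf_subset {L : Set (Euc n)} (hL : IsCompact L) (hLe : L ⊆ e.target)
    {u : Euc n → Alt n m} (hu : ∀ y ∉ L, u y = 0) : formSupport (formOf e u) ⊆ e.symm '' L :=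
  closure_minimal (fun _ hx => by_contra fun h => hx (formOf_eq_zero hu h))
    (isCompact_symm_image hL hLe).isClosed

theorem chartRep_formOf_eventuallyEq_zero {L : Set (Euc n)} (hL : IsCompact L)
    (hLe : L ⊆ e.target) {u : Euc n → Alt n m} (hu : ∀ y ∉ L, u y = 0) {y : Euc n}
    (hy : y ∈ e'.target) (hyL : e'.symm y ∉ e.symm '' L) :
    chartRep e' (formOf e u) =ᶠ[𝓝 y] 0 := by
  have hcl := (isCompact_symm_image hL hLe).isClosed
  filter_upwards [(e'.continuousAt_symm hy).preimage_mem_nhds (hcl.isOpen_compl.mem_nhds hyL)]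
    with z hz
  exact chartRep_eq_zero (formOf_eq_zero hu hz)

theorem contDiffOn_pullback_fderiv {θ : Euc n → Euc n} {O : Set (Euc n)} (hO : IsOpen O)
    (hθ : ContDiffOn ℝ ∞ θ O) {w : Euc n → Alt n m} (hw : ContDiffOn ℝ ∞ w O) :
    ContDiffOn ℝ ∞ (fun y => (w y).compContinuousLinearMap (fderiv ℝ θ y)) O :=
  (contDiff_compContinuousLinearMap n m).comp_contDiffOn
    (hw.prodMk (hθ.fderiv_of_isOpen hO (by simp)))

/-- Over the overlap with `e` the change of charts formula applies. Any other point avoids `e.symm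
'' L`, which is compact and hence closed as `M` is Hausdorff, so the form vanishes near it. -/
theorem isSmoothForm_formOf (he : e ∈ IsManifold.maximalAtlas (𝓡 n) ∞ M)
    {L : Set (Euc n)} (hL : IsCompact L) (hLe : L ⊆ e.target) {u : Euc n → Alt n m}
    (hu : ContDiff ℝ ∞ u) (huL : ∀ y ∉ L, u y = 0) : IsSmoothForm (formOf e u) := by
  intro e' he' y hy
  refine ContDiffAt.contDiffWithinAt ?_
  by_cases h : e'.symm y ∈ e.source
  · have hO := (isOpen_overlap e' e).mem_nhds ⟨hy, h⟩
    have hθ := contDiffOn_transition he' he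
    have := (contDiffOn_pullback_fderiv (isOpen_overlap e' e) hθ
      (hu.comp_contDiffOn hθ)).contDiffAt hO
    refine this.congr_of_eventuallyEq ?_
    filter_upwards [hO] with z hz
    rw [chartRep_eq_of_mem he' he _ hz.1 hz.2, chartRep_formOf he _ (e.map_source hz.2)]
    rfl
  · refine (contDiffAt_const (c := 0)).congr_of_eventuallyEq
      (chartRep_formOf_eventuallyEq_zero hL hLe huL hy ?_)
    rintro ⟨z, hz, hzy⟩
    exact h (hzy ▸ e.map_target (hLe hz))

variable (n m) in
/-- The smooth functions on `ℝⁿ`, with values in the alternating forms, that vanish outside `L`. -/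
def smoothSupportedIn (L : Set (Euc n)) : Submodule ℝ (Euc n → Alt n m) where
  carrier := {u | ContDiff ℝ ∞ u ∧ ∀ y ∉ L, u y = 0}
  zero_mem' := ⟨contDiff_const, fun _ _ => rfl⟩
  add_mem' h₁ h₂ := ⟨h₁.1.add h₂.1, fun y hy => by simp [h₁.2 y hy, h₂.2 y hy]⟩
  smul_mem' c _ h := ⟨contDiff_const.smul h.1, fun y hy => by simp [h.2 y hy]⟩

theorem formOf_add (e : OpenPartialHomeomorph M (Euc n)) (u v : Euc n → Alt n m) :
    formOf e (u + v) = formOf e u + formOf e v := by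
  funext x
  by_cases h : x ∈ e.source
  · simp only [Pi.add_apply, formOf_of_mem h]
    rfl
  · simp [formOf_of_notMem h]

theorem formOf_smul (e : OpenPartialHomeomorph M (Euc n)) (c : ℝ) (u : Euc n → Alt n m) :
    formOf e (c • u) = c • formOf e u := by
  funext x
  by_cases h : x ∈ e.source
  · simp only [Pi.smul_apply, formOf_of_mem h]
    rfl
  · simp [formOf_of_notMem h]

/-- Transport of smooth functions supported in `L` to test forms on `M`. -/
def testFormOf (he : e ∈ IsManifold.maximalAtlas (𝓡 n) ∞ M) {L : Set (Euc n)} (hL : IsCompact L)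
    (hLe : L ⊆ e.target) : smoothSupportedIn n m L →ₗ[ℝ] testForms n M m where
  toFun u := ⟨formOf e u.1, isSmoothForm_formOf he hL hLe u.2.1 u.2.2,
    (isCompact_symm_image hL hLe).of_isClosed_subset isClosed_closure
      (formSupport_formOf_subset hL hLe u.2.2)⟩
  map_add' u v := Subtype.ext (formOf_add e u.1 v.1)
  map_smul' c u := Subtype.ext (formOf_smul e c u.1)

end Charts

/-! ### Comparing derivatives in two charts -/

section Estimates

variable {n m : ℕ} {M : Type*} [TopologicalSpace M] [ChartedSpace (EuclideanSpace ℝ (Fin n)) M]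
  [IsManifold (𝓡 n) ∞ M] [T2Space M] {e e' : OpenPartialHomeomorph M (Euc n)}

/-- The normalization `1 ≤ C` allows `C ≤ C ^ j` for `j ≥ 1`, the shape of bound required when
differentiating a composition. -/
theorem exists_bound_iteratedFDeriv {E F : Type*} [NormedAddCommGroup E] [NormedSpace ℝ E]
    [NormedAddCommGroup F] [NormedSpace ℝ F] {w : E → F} {O K : Set E} (hO : IsOpen O)
    (hw : ContDiffOn ℝ ∞ w O) (hK : IsCompact K) (hKO : K ⊆ O) (r : ℕ) :
    ∃ C : ℝ, 1 ≤ C ∧ ∀ i ≤ r, ∀ y ∈ K, ‖iteratedFDerivWithin ℝ i w O y‖ ≤ C := by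
  induction r with
  | zero =>
    obtain ⟨C, hC⟩ := hK.exists_bound_of_continuousOn
      ((hw.continuousOn_iteratedFDerivWithin (m := 0) (by simp) hO.uniqueDiffOn).mono hKO)
    refine ⟨max C 1, le_max_right _ _, fun i hi y hy => ?_⟩
    obtain rfl : i = 0 := by omega
    exact (hC y hy).trans (le_max_left _ _)
  | succ r ih =>
    obtain ⟨C, hC1, hC⟩ := ih
    obtain ⟨C', hC'⟩ := hK.exists_bound_of_continuousOn
      ((hw.continuousOn_iteratedFDerivWithin (m := r + 1) (by exact_mod_cast le_top)
        hO.uniqueDiffOn).mono hKO)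
    refine ⟨max C C', hC1.trans (le_max_left _ _), fun i hi y hy => ?_⟩
    rcases Nat.lt_or_ge i (r + 1) with h | h
    · exact (hC i (by omega) y hy).trans (le_max_left _ _)
    · obtain rfl : i = r + 1 := by omega
      exact (hC' y hy).trans (le_max_right _ _)

/-- The derivatives of the coefficients of a form in one chart are controlled by those in
another chart. -/
theorem exists_bound_chartRep_formOf (he : e ∈ IsManifold.maximalAtlas (𝓡 n) ∞ M)
    (he' : e' ∈ IsManifold.maximalAtlas (𝓡 n) ∞ M) {L L' : Set (Euc n)} (hL : IsCompact L)
    (hLe : L ⊆ e.target) (hL' : IsCompact L') (hLe' : L' ⊆ e'.target) (r : ℕ) :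
    ∃ C : ℝ, 0 ≤ C ∧ ∀ u ∈ smoothSupportedIn n m L, ∀ B : ℝ, 0 ≤ B →
      (∀ i ≤ r, ∀ x ∈ L, ‖iteratedFDeriv ℝ i u x‖ ≤ B) →
        ∀ y ∈ L', ‖iteratedFDeriv ℝ r (chartRep e' (formOf e u)) y‖ ≤ C * B := by
  set O := e'.target ∩ e'.symm ⁻¹' e.source with hOdef
  have hO : IsOpen O := isOpen_overlap e' e
  set θ : Euc n → Euc n := fun y => e (e'.symm y) with hθdef
  have hθ : ContDiffOn ℝ ∞ θ O := contDiffOn_transition he' he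
  -- The part of `L'` where the form can be nonzero. It is compact and inside the overlap, so the
  -- transition map has bounded derivatives on it.
  let K := L' ∩ e'.symm ⁻¹' (e.symm '' L)
  have hK : IsCompact K := hL'.of_isClosed_subset
    ((e'.continuousOn_symm.mono hLe').preimage_isClosed_of_isClosed hL'.isClosed
      (isCompact_symm_image hL hLe).isClosed) inter_subset_left
  have hsrc : e.symm '' L ⊆ e.source := by
    rintro _ ⟨z, hz, rfl⟩
    exact e.map_target (hLe hz)
  have hKO : K ⊆ O := fun y hy => ⟨hLe' hy.1, hsrc hy.2⟩
  have hKL : ∀ y ∈ K, θ y ∈ L := by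
    rintro y ⟨_, z, hz, hzy⟩
    simp only [hθdef]
    rw [← hzy, e.right_inv (hLe hz)]
    exact hz
  -- On the overlap the coefficients are `W y (u (θ y))`: the Leibniz rule separates `W` from `u ∘
  -- θ`, and the composition estimate handles `u ∘ θ`. The constant below is the resulting sum.
  let W : Euc n → Alt n m →L[ℝ] Alt n m := fun y =>
    ContinuousAlternatingMap.compContinuousLinearMapCLM (fderiv ℝ θ y)
  have hW : ContDiffOn ℝ ∞ W O := contDiffOn_clm_apply.2 fun a =>
    contDiffOn_pullback_fderiv hO hθ contDiffOn_const
  obtain ⟨D, hD1, hD⟩ := exists_bound_iteratedFDeriv hO hθ hK hKO r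
  obtain ⟨A, hA1, hA⟩ := exists_bound_iteratedFDeriv hO hW hK hKO r
  refine ⟨∑ i ∈ Finset.range (r + 1), (r.choose i) * A * ((r - i).factorial * D ^ (r - i)),
    by positivity, fun u hu B hB0 hB y hy => ?_⟩
  by_cases hyL : e'.symm y ∈ e.symm '' L
  · have hyK : y ∈ K := ⟨hy, hyL⟩
    have hyO := hKO hyK
    have hcomp : ContDiffOn ℝ ∞ (u ∘ θ) O := hu.1.comp_contDiffOn hθ
    have heq : EqOn (chartRep e' (formOf e u)) (fun y => W y ((u ∘ θ) y)) O := fun z hz => by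
      rw [chartRep_eq_of_mem he' he _ hz.1 hz.2, chartRep_formOf he _ (e.map_source hz.2)]
      rfl
    rw [← iteratedFDerivWithin_of_isOpen r hO hyO,
      iteratedFDerivWithin_congr heq hyO]
    refine (norm_iteratedFDerivWithin_clm_apply (N := ∞) hW hcomp hO.uniqueDiffOn hyO
      (by exact_mod_cast le_top)).trans ?_
    rw [Finset.sum_mul]
    refine Finset.sum_le_sum fun i hi => ?_
    have hir : i ≤ r := by simpa [Nat.lt_succ_iff] using hi
    have hle : ∀ k : ℕ, (k : ℕ∞ω) ≤ ∞ := fun k => by exact_mod_cast le_top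
    have hb : ‖iteratedFDerivWithin ℝ (r - i) (u ∘ θ) O y‖ ≤
        (r - i).factorial * B * D ^ (r - i) := by
      refine norm_iteratedFDerivWithin_comp_le (N := ∞) (t := univ) hu.1.contDiffOn hθ
        (hle _) uniqueDiffOn_univ hO.uniqueDiffOn (mapsTo_univ _ _) hyO
        (fun j hj => ?_) fun j hj1 hj => ?_
      · rw [iteratedFDerivWithin_univ]
        exact hB j (by omega) _ (hKL y hyK)
      · exact (hD j (by omega) y hyK).trans (le_self_pow₀ hD1 (by omega))
    calc (r.choose i : ℝ) * ‖iteratedFDerivWithin ℝ i W O y‖ *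
          ‖iteratedFDerivWithin ℝ (r - i) (u ∘ θ) O y‖
        ≤ (r.choose i : ℝ) * A * ((r - i).factorial * B * D ^ (r - i)) := by
          gcongr
          exact hA i hir y hyK
      _ = (r.choose i) * A * ((r - i).factorial * D ^ (r - i)) * B := by ring
  · have h0 := chartRep_formOf_eventuallyEq_zero hL hLe hu.2 (hLe' hy) hyL
    rw [(h0.iteratedFDeriv ℝ r).eq_of_nhds]
    have : iteratedFDeriv ℝ r (0 : Euc n → Alt n m) y = 0 := congrFun iteratedFDeriv_fun_zero y
    rw [this, norm_zero]
    positivity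

end Estimates

/-- A linear functional on `X` that is bounded in terms of a linear map `J : X → Y` factors through
a continuous linear functional on `Y`. -/
theorem exists_extension_of_bound {X Y : Type*} [AddCommGroup X] [Module ℝ X]
    [NormedAddCommGroup Y] [NormedSpace ℝ Y] (J : X →ₗ[ℝ] Y) (t : X →ₗ[ℝ] ℝ) {C : ℝ}
    (h : ∀ x, |t x| ≤ C * ‖J x‖) : ∃ Φ : Y →L[ℝ] ℝ, ∀ x, t x = Φ (J x) := by
  obtain ⟨s, hs⟩ := J.rangeRestrict.exists_rightInverse_of_surjective
    (LinearMap.range_eq_top.2 J.surjective_rangeRestrict)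
  have hs' : ∀ y : LinearMap.range J, J (s y) = y := fun y =>
    congrArg Subtype.val (LinearMap.congr_fun hs y)
  have hf : ∀ y, ‖(t ∘ₗ s) y‖ ≤ C * ‖y‖ := fun y => by
    have := h (s y)
    rw [hs' y] at this
    exact this
  obtain ⟨Φ, hΦ, -⟩ := exists_extension_norm_eq (𝕜 := ℝ) (LinearMap.range J)
    ((t ∘ₗ s).mkContinuous C hf)
  refine ⟨Φ, fun x => ?_⟩
  refine Eq.trans ?_ (hΦ ⟨J x, x, rfl⟩).symm
  -- The bound forces `t` to vanish on the kernel of `J`, which contains `x - s (J x)`; so the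
  -- choice of section does not matter.
  have h2 := h (x - s ⟨J x, x, rfl⟩)
  rw [map_sub, map_sub, hs', sub_self, norm_zero, mul_zero] at h2
  exact sub_eq_zero.1 (abs_nonpos_iff.1 h2)

/-! ### Currents have locally finite order -/

section FiniteOrder

variable {n m : ℕ} {M : Type*} [TopologicalSpace M] [ChartedSpace (EuclideanSpace ℝ (Fin n)) M]
  [IsManifold (𝓡 n) ∞ M] [T2Space M] {e : OpenPartialHomeomorph M (Euc n)}

/-- Locally a current has finite order. -/
theorem exists_bound_current (he : e ∈ IsManifold.maximalAtlas (𝓡 n) ∞ M) {L : Set (Euc n)}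
    (hL : IsCompact L) (hLe : L ⊆ e.target) (T : currents n m M) :
    ∃ r : ℕ, ∃ C : ℝ, 0 ≤ C ∧ ∀ u : smoothSupportedIn n m L, ∀ B : ℝ, 0 ≤ B →
      (∀ i ≤ r, ∀ x ∈ L, ‖iteratedFDeriv ℝ i u.1 x‖ ≤ B) →
        |T.1 (testFormOf he hL hLe u)| ≤ C * B := by
  -- If no order works, choose for each order `r` a violation with constant `r + 1` and rescale it
  -- so that `T` takes a value of modulus `1`. All derivatives up to order `r` are then at most `1 /
  -- (r + 1)`, so the rescaled forms tend to zero, against continuity of `T`.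
  by_contra! hcon
  have h1 : ∀ r : ℕ, ∃ u : smoothSupportedIn n m L, ∃ B : ℝ, 0 ≤ B ∧
      (∀ i ≤ r, ∀ x ∈ L, ‖iteratedFDeriv ℝ i u.1 x‖ ≤ B) ∧
        ((r : ℝ) + 1) * B < |T.1 (testFormOf he hL hLe u)| := fun r => hcon r _ (by positivity)
  choose u B hB hu hT using h1
  have hpos : ∀ r, 0 < |T.1 (testFormOf he hL hLe (u r))| := fun r =>
    (mul_nonneg (by positivity) (hB r)).trans_lt (hT r)
  let c : ℕ → ℝ := fun r => |T.1 (testFormOf he hL hLe (u r))|⁻¹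
  let v : ℕ → smoothSupportedIn n m L := fun r => c r • u r
  have hv : ∀ r, ∀ i ≤ r, ∀ x ∈ L, ‖iteratedFDeriv ℝ i (v r).1 x‖ ≤ 1 / ((r : ℝ) + 1) := by
    intro r i hi x hx
    have : iteratedFDeriv ℝ i (v r).1 x = c r • iteratedFDeriv ℝ i (u r).1 x :=
      iteratedFDeriv_const_smul_apply ((u r).2.1.contDiffAt.of_le (by exact_mod_cast le_top))
    rw [this, norm_smul, Real.norm_of_nonneg (inv_nonneg.2 (hpos r).le)]
    calc c r * ‖iteratedFDeriv ℝ i (u r).1 x‖ ≤ c r * B r := by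
          gcongr
          exact hu r i hi x hx
      _ ≤ 1 / ((r : ℝ) + 1) := by
          rw [le_div_iff₀ (by positivity), mul_assoc, inv_mul_le_iff₀ (hpos r), mul_one, mul_comm]
          exact (hT r).le
  have hzero : TendstoZero fun r => testFormOf he hL hLe (v r) := by
    refine ⟨⟨e.symm '' L, isCompact_symm_image hL hLe, fun r =>
      formSupport_formOf_subset hL hLe (v r).2.2⟩, fun e' he' L' hLe' hL' j => ?_⟩
    obtain ⟨C, hC0, hC⟩ := exists_bound_chartRep_formOf (m := m) he he' hL hLe hL' hLe' j
    have hlim : Tendsto (fun r : ℕ => C * (1 / ((r : ℝ) + 1))) atTop (𝓝 0) := by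
      simpa using tendsto_one_div_add_atTop_nhds_zero_nat.const_mul C
    rw [Metric.tendstoUniformlyOn_iff]
    intro δ hδ
    filter_upwards [hlim.eventually (gt_mem_nhds hδ), eventually_ge_atTop j] with r hr hjr y hy
    rw [Pi.zero_apply, dist_zero_left]
    exact (hC (v r).1 (v r).2 _ (by positivity)
      (fun i hi x hx => hv r i (hi.trans hjr) x hx) y hy).trans_lt hr
  have hlim := (T.2 _ hzero).abs
  have hone : ∀ r, |T.1 (testFormOf he hL hLe (v r))| = 1 := fun r => by
    rw [map_smul, map_smul, smul_eq_mul, abs_mul, abs_of_nonneg (inv_nonneg.2 (hpos r).le)]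
    exact inv_mul_cancel₀ (hpos r).ne'
  simp only [hone, abs_zero] at hlim
  exact one_ne_zero (tendsto_nhds_unique tendsto_const_nhds hlim)

/-- The `r`-jets of functions supported in `L`, as continuous functions on `L`. -/
def jetOn (n m r : ℕ) (L : Set (Euc n)) :
    smoothSupportedIn n m L →ₗ[ℝ] C(L, Jet (Euc n) (Alt n m) r) where
  toFun u := ⟨fun x => jet r u.1 x, (contDiff_jet r u.2.1).continuous.comp continuous_subtype_val⟩
  map_add' u v := by
    ext1 x
    exact jet_add r u.2.1 v.2.1 x
  map_smul' c u := by
    ext1 x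
    exact jet_const_smul r c u.2.1 x

/-- Locally a current is given by a continuous linear functional on continuous jets. -/
theorem exists_jet_functional (he : e ∈ IsManifold.maximalAtlas (𝓡 n) ∞ M) {L : Set (Euc n)}
    [CompactSpace L] (hL : IsCompact L) (hLe : L ⊆ e.target) (T : currents n m M) :
    ∃ r : ℕ, ∃ Φ : C(L, Jet (Euc n) (Alt n m) r) →L[ℝ] ℝ, ∀ u : smoothSupportedIn n m L,
      T.1 (testFormOf he hL hLe u) = Φ (jetOn n m r L u) := by
  obtain ⟨r, C, hC0, hC⟩ := exists_bound_current he hL hLe T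
  have hC' : ∀ u : smoothSupportedIn n m L,
      |T.1 (testFormOf he hL hLe u)| ≤ C * ‖jetOn n m r L u‖ := fun u =>
    hC u _ (norm_nonneg (jetOn n m r L u)) fun i hi x hx =>
      (norm_le_pi_norm (jet r u.1 x) ⟨i, Nat.lt_succ_of_le hi⟩).trans
        ((jetOn n m r L u).norm_coe_le_norm ⟨x, hx⟩)
  let t : smoothSupportedIn n m L →ₗ[ℝ] ℝ := T.1 ∘ₗ testFormOf he hL hLe
  let J : smoothSupportedIn n m L →ₗ[ℝ] C(L, Jet (Euc n) (Alt n m) r) := jetOn n m r L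
  obtain ⟨Φ, hΦ⟩ := exists_extension_of_bound (X := smoothSupportedIn n m L)
    (Y := C(L, Jet (Euc n) (Alt n m) r)) J t hC'
  exact ⟨r, Φ, hΦ⟩

end FiniteOrder

/-! ### The group action in charts -/

section Action

variable {n m : ℕ} {G : Type*} [TopologicalSpace G] [Group G]
  {M : Type*} [TopologicalSpace M] [ChartedSpace (EuclideanSpace ℝ (Fin n)) M]
  [IsManifold (𝓡 n) ∞ M] [MulAction G M]
  {e e' : OpenPartialHomeomorph M (Euc n)}

/-- The pullback of a form under the action of a group element. -/
def translateForm (g : G) (α : FormField n M m) : FormField n M m :=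
  pullbackField (fun x : M => g • x) α

theorem isSmoothForm_translateForm (k : ℕ) [ChartedSpace (EuclideanSpace ℝ (Fin k)) G]
    [ContMDiffSMul (𝓡 k) (𝓡 n) ∞ G M] (g : G) {α : FormField n M m} (hα : IsSmoothForm α) :
    IsSmoothForm (translateForm g α) :=
  isSmoothForm_pullbackField (ContMDiffSMul.contMDiff_const_smul (I := 𝓡 k) g) hα

/-- The expression of the action in the charts `e` and `e'`. -/
def actionRep (e e' : OpenPartialHomeomorph M (Euc n)) (g : G) (y : Euc n) : Euc n :=
  e' (g • e.symm y)

variable (G) in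
/-- The domain of `actionRep e e'`. -/
def actionDomain (e e' : OpenPartialHomeomorph M (Euc n)) : Set (G × Euc n) :=
  {q | q.2 ∈ e.target ∧ q.1 • e.symm q.2 ∈ e'.source}

theorem contMDiffOn_smul_symm (k : ℕ) [ChartedSpace (EuclideanSpace ℝ (Fin k)) G]
    [LieGroup (𝓡 k) ∞ G] [ContMDiffSMul (𝓡 k) (𝓡 n) ∞ G M]
    (he : e ∈ IsManifold.maximalAtlas (𝓡 n) ∞ M) :
    ContMDiffOn ((𝓡 k).prod (𝓡 n)) (𝓡 n) ∞ (fun q : G × Euc n => q.1 • e.symm q.2)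
      (univ ×ˢ e.target) := fun q hq =>
  (contMDiffAt_fst.smul (I := 𝓡 k) (I' := 𝓡 n)
    ((contMDiffAt_symm_of_mem he hq.2).comp q contMDiffAt_snd)).contMDiffWithinAt

theorem isOpen_actionDomain (k : ℕ) [ChartedSpace (EuclideanSpace ℝ (Fin k)) G]
    [LieGroup (𝓡 k) ∞ G] [ContMDiffSMul (𝓡 k) (𝓡 n) ∞ G M]
    (he : e ∈ IsManifold.maximalAtlas (𝓡 n) ∞ M)
    (e' : OpenPartialHomeomorph M (Euc n)) : IsOpen (actionDomain G e e') := by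
  have h := (contMDiffOn_smul_symm (G := G) k he).continuousOn.isOpen_inter_preimage
    (isOpen_univ.prod e.open_target) e'.open_source
  convert h using 1
  ext q
  simp [actionDomain]

theorem contMDiffAt_actionRep (k : ℕ) [ChartedSpace (EuclideanSpace ℝ (Fin k)) G]
    [LieGroup (𝓡 k) ∞ G] [ContMDiffSMul (𝓡 k) (𝓡 n) ∞ G M]
    (he : e ∈ IsManifold.maximalAtlas (𝓡 n) ∞ M)
    (he' : e' ∈ IsManifold.maximalAtlas (𝓡 n) ∞ M) {q : G × Euc n}
    (hq : q ∈ actionDomain G e e') :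
    ContMDiffAt ((𝓡 k).prod (𝓡 n)) (𝓡 n) ∞
      (Function.uncurry (actionRep (G := G) e e')) q :=
  (contMDiffAt_of_mem he' hq.2).comp q ((contMDiffOn_smul_symm k he).contMDiffAt
    ((isOpen_univ.prod e.open_target).mem_nhds ⟨mem_univ _, hq.1⟩))

theorem contMDiffAt_fderiv_actionRep (k : ℕ) [ChartedSpace (EuclideanSpace ℝ (Fin k)) G]
    [LieGroup (𝓡 k) ∞ G] [ContMDiffSMul (𝓡 k) (𝓡 n) ∞ G M]
    (he : e ∈ IsManifold.maximalAtlas (𝓡 n) ∞ M)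
    (he' : e' ∈ IsManifold.maximalAtlas (𝓡 n) ∞ M) {q : G × Euc n}
    (hq : q ∈ actionDomain G e e') :
    ContMDiffAt ((𝓡 k).prod (𝓡 n)) 𝓘(ℝ, Euc n →L[ℝ] Euc n) ∞
      (fun q : G × Euc n => fderiv ℝ (actionRep e e' q.1) q.2) q :=
  have : IsManifold (𝓡 k) ∞ G := LieGroup.toContMDiffMul.toIsManifold
  contMDiffAt_fderiv_right (contMDiffAt_actionRep k he he' hq)

theorem chartRep_translateForm (k : ℕ) [ChartedSpace (EuclideanSpace ℝ (Fin k)) G]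
    [LieGroup (𝓡 k) ∞ G] [ContMDiffSMul (𝓡 k) (𝓡 n) ∞ G M]
    (he : e ∈ IsManifold.maximalAtlas (𝓡 n) ∞ M)
    (he' : e' ∈ IsManifold.maximalAtlas (𝓡 n) ∞ M) (α : FormField n M m) {q : G × Euc n}
    (hq : q ∈ actionDomain G e e') :
    chartRep e (translateForm q.1 α) q.2 =
      (chartRep e' α (actionRep e e' q.1 q.2)).compContinuousLinearMap
        (fderiv ℝ (actionRep e e' q.1) q.2) :=
  chartRep_pullbackField (ContMDiffSMul.contMDiff_const_smul (I := 𝓡 k) q.1) he he' α hq.1 hq.2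

/-- No single chart contains the images under all group elements. Centring the second chart at the
image point makes the joint statements below local in `(g, y)`. -/
theorem mem_actionDomain_chartAt {q : G × Euc n} (hq : q.2 ∈ e.target) :
    q ∈ actionDomain G e (chartAt (Euc n) (q.1 • e.symm q.2)) :=
  ⟨hq, mem_chart_source _ _⟩

/-- The coefficients of the translates of a smooth form depend smoothly on the group element. -/
theorem contMDiffOn_chartRep_translateForm (k : ℕ) [ChartedSpace (EuclideanSpace ℝ (Fin k)) G]
    [LieGroup (𝓡 k) ∞ G] [ContMDiffSMul (𝓡 k) (𝓡 n) ∞ G M]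
    (he : e ∈ IsManifold.maximalAtlas (𝓡 n) ∞ M)
    {α : FormField n M m} (hα : IsSmoothForm α) :
    ContMDiffOn ((𝓡 k).prod (𝓡 n)) 𝓘(ℝ, Alt n m) ∞
      (Function.uncurry fun (g : G) y => chartRep e (translateForm g α) y)
      (univ ×ˢ e.target) := by
  intro q hq
  have he' : chartAt (Euc n) (q.1 • e.symm q.2) ∈ IsManifold.maximalAtlas (𝓡 n) ∞ M :=
    IsManifold.chart_mem_maximalAtlas _
  have hqd : q ∈ actionDomain G e (chartAt (Euc n) (q.1 • e.symm q.2)) :=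
    mem_actionDomain_chartAt hq.2
  set e' := chartAt (Euc n) (q.1 • e.symm q.2)
  have h1 : ContMDiffAt ((𝓡 k).prod (𝓡 n)) 𝓘(ℝ, Alt n m) ∞
      (fun q : G × Euc n => chartRep e' α (actionRep e e' q.1 q.2)) q :=
    (((hα e' he').contDiffAt (e'.open_target.mem_nhds (e'.map_source hqd.2))).contMDiffAt).comp q
      (contMDiffAt_actionRep k he he' hqd)
  have h2 := (contDiff_compContinuousLinearMap n m).contMDiff.contMDiffAt.comp q
    (h1.prodMk_space (contMDiffAt_fderiv_actionRep k he he' hqd))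
  refine (h2.congr_of_eventuallyEq ?_).contMDiffWithinAt
  filter_upwards [(isOpen_actionDomain k he e').mem_nhds hqd] with p hp
  exact chartRep_translateForm k he he' α hp

/-- If test forms converge to zero, then so do the coefficients of their translates, uniformly in
the group element. -/
theorem tendstoUniformlyOn_chartRep_translateForm (k : ℕ)
    [ChartedSpace (EuclideanSpace ℝ (Fin k)) G]
    [LieGroup (𝓡 k) ∞ G] [ContMDiffSMul (𝓡 k) (𝓡 n) ∞ G M]
    [CompactSpace G]
    (he : e ∈ IsManifold.maximalAtlas (𝓡 n) ∞ M) {K : Set (Euc n)} (hK : IsCompact K)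
    (hKe : K ⊆ e.target) {α : ℕ → testForms n M m} (hα : TendstoZero α) :
    TendstoUniformlyOn (fun j (q : G × Euc n) => chartRep e (translateForm q.1 (α j).1) q.2) 0
      atTop (univ ×ˢ K) := by
  -- Since `G × K` is compact, local uniformity suffices, and a single target chart can be used near
  -- each point.
  rw [← tendstoLocallyUniformlyOn_iff_tendstoUniformlyOn_of_compact (isCompact_univ.prod hK),
    Metric.tendstoLocallyUniformlyOn_iff]
  intro c hc q hq
  have he' : chartAt (Euc n) (q.1 • e.symm q.2) ∈ IsManifold.maximalAtlas (𝓡 n) ∞ M :=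
    IsManifold.chart_mem_maximalAtlas _
  have hqd : q ∈ actionDomain G e (chartAt (Euc n) (q.1 • e.symm q.2)) :=
    mem_actionDomain_chartAt (hKe hq.2)
  set e' := chartAt (Euc n) (q.1 • e.symm q.2)
  obtain ⟨L', hL', hqL', hLe'⟩ := exists_compact_subset e'.open_target (e'.map_source hqd.2)
  have hcont := (contMDiffAt_actionRep k he he' hqd).continuousAt
  have hcont' := (contMDiffAt_fderiv_actionRep k he he' hqd).continuousAt.norm
  set D := ‖fderiv ℝ (actionRep e e' q.1) q.2‖ + 1
  have hDpos : 0 < D := by positivity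
  have ht : {p | p ∈ actionDomain G e e' ∧ actionRep e e' p.1 p.2 ∈ L' ∧
      ‖fderiv ℝ (actionRep e e' p.1) p.2‖ < D} ∈ 𝓝 q := by
    filter_upwards [(isOpen_actionDomain k he e').mem_nhds hqd,
      hcont.preimage_mem_nhds (mem_interior_iff_mem_nhds.1 hqL'),
      hcont'.eventually (gt_mem_nhds (lt_add_one _))] with p h1 h2 h3 using ⟨h1, h2, h3⟩
  refine ⟨_, mem_nhdsWithin_of_mem_nhds ht, ?_⟩
  -- Pulling back an `m`-form by a map with derivative of norm at most `D` costs a factor `D ^ m`;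
  -- only convergence of order `0` is needed.
  have hz := Metric.tendstoUniformlyOn_iff.1 (hα.2 e' he' L' hLe' hL' 0) (c / D ^ m)
    (by positivity)
  filter_upwards [hz] with j hj p hp
  have h4 := hj _ hp.2.1
  rw [Pi.zero_apply, dist_zero_left, norm_iteratedFDeriv_zero] at h4
  rw [Pi.zero_apply, dist_zero_left, chartRep_translateForm k he he' _ hp.1]
  calc _ ≤ ‖chartRep e' (α j).1 (actionRep e e' p.1 p.2)‖ *
        ‖fderiv ℝ (actionRep e e' p.1) p.2‖ ^ Fintype.card (Fin m) :=
        ContinuousAlternatingMap.norm_compContinuousLinearMap_le _ _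
    _ ≤ ‖chartRep e' (α j).1 (actionRep e e' p.1 p.2)‖ * D ^ m := by
        rw [Fintype.card_fin]
        gcongr
        exact hp.2.2.le
    _ < c / D ^ m * D ^ m := by gcongr
    _ = c := by field_simp

end Action

/-! ### Smoothness of the determinant and of pullback of alternating forms -/

section Determinant

theorem contDiff_continuousLinearMap_det (n : ℕ) :
    ContDiff ℝ ∞ (fun A : Euc n →L[ℝ] Euc n => A.det) := by
  let b := (EuclideanSpace.basisFun (Fin n) ℝ).toBasis
  have h : (fun A : Euc n →L[ℝ] Euc n => A.det) = fun A : Euc n →L[ℝ] Euc n =>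
      ∑ σ : Equiv.Perm (Fin n), (Equiv.Perm.sign σ : ℝ) * ∏ i, (A (b i)) (σ i) := by
    funext A
    rw [ContinuousLinearMap.det, ← LinearMap.det_toMatrix b, Matrix.det_apply']
    simp [LinearMap.toMatrix_apply, b]
  rw [h]
  refine ContDiff.sum fun σ _ => contDiff_const.mul (contDiff_prod fun i _ => ?_)
  exact (EuclideanSpace.proj (σ i)).contDiff.comp
    (ContinuousLinearMap.apply ℝ (Euc n) (b i)).contDiff

/-- The pullback operation on alternating forms depends smoothly on the linear map. -/
theorem contDiff_compContinuousLinearMapCLM (n m : ℕ) :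
    ContDiff ℝ ∞ (fun A : Euc n →L[ℝ] Euc n =>
      (ContinuousAlternatingMap.compContinuousLinearMapCLM A : Alt n m →L[ℝ] Alt n m)) :=
  contDiff_clm_apply_iff.2 fun a => (contDiff_compContinuousLinearMap n m).comp
    ((contDiff_const (c := a)).prodMk contDiff_id)

end Determinant

theorem continuous_of_continuousOn_of_eq_zero {X F : Type*} [TopologicalSpace X]
    [TopologicalSpace F] [Zero F] {f : X → F} {U C : Set X} (hU : IsOpen U) (hC : IsClosed C)
    (hCU : C ⊆ U) (hf : ContinuousOn f U) (h0 : ∀ x ∉ C, f x = 0) : Continuous f := by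
  rw [continuous_iff_continuousAt]
  intro x
  by_cases hx : x ∈ U
  · exact hf.continuousAt (hU.mem_nhds hx)
  · refine (continuousAt_const (y := 0)).congr ?_
    filter_upwards [hC.isOpen_compl.mem_nhds fun h => hx (hCU h)] with y hy using (h0 y hy).symm

theorem exists_bound_apply_of_isCompact {X A : Type*} [TopologicalSpace X] [NormedAddCommGroup A]
    [NormedSpace ℝ A] {K : Set X} (hK : IsCompact K) {f : X → A →L[ℝ] ℝ} (hf : Continuous f) :
    ∃ C : ℝ, 0 ≤ C ∧ ∀ z ∈ K, ∀ a, |f z a| ≤ C * ‖a‖ := by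
  obtain ⟨C, hC⟩ := hK.exists_bound_of_continuousOn hf.continuousOn
  refine ⟨max C 0, le_max_right _ _, fun z hz a => ((f z).le_opNorm a).trans ?_⟩
  gcongr
  exact (hC z hz).trans (le_max_left _ _)

variable (n m : ℕ) in
/-- The smooth functions on `ℝⁿ`, with values in the dual of the alternating forms, that vanish
outside `K`. -/
def coefficientsIn (K : Set (Euc n)) : Submodule ℝ (Euc n → Alt n m →L[ℝ] ℝ) where
  carrier := {F | ContDiff ℝ ∞ F ∧ ∀ y ∉ K, F y = 0}
  zero_mem' := ⟨contDiff_const, fun _ _ => rfl⟩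
  add_mem' h₁ h₂ := ⟨h₁.1.add h₂.1, fun y hy => by simp [h₁.2 y hy, h₂.2 y hy]⟩
  smul_mem' c _ h := ⟨h.1.const_smul c, fun y hy => by simp [h.2 y hy]⟩

/-! ### Averaging over the group, and invariance of the average -/

section Average

variable {n m : ℕ} {G : Type*} [TopologicalSpace G] [Group G] [CompactSpace G] [T2Space G]
  {M : Type*} [TopologicalSpace M] [ChartedSpace (EuclideanSpace ℝ (Fin n)) M]
  [IsManifold (𝓡 n) ∞ M] [MulAction G M]
  {e e' : OpenPartialHomeomorph M (Euc n)} {K : Set (Euc n)}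

/-- The pairing of a form with coefficients given in the chart `e`. -/
def pairing (e : OpenPartialHomeomorph M (Euc n)) (F : Euc n → Alt n m →L[ℝ] ℝ)
    (α : FormField n M m) : ℝ := ∫ z, F z (chartRep e α z)

theorem continuous_coefficient_apply (k : ℕ) [ChartedSpace (EuclideanSpace ℝ (Fin k)) G]
    [LieGroup (𝓡 k) ∞ G] [ContMDiffSMul (𝓡 k) (𝓡 n) ∞ G M]
    (he : e ∈ IsManifold.maximalAtlas (𝓡 n) ∞ M) (hK : IsCompact K) (hKe : K ⊆ e.target)
    (F : coefficientsIn n m K) {α : FormField n M m} (hα : IsSmoothForm α) :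
    Continuous (fun q : G × Euc n => F.1 q.2 (chartRep e (translateForm q.1 α) q.2)) := by
  refine continuous_of_continuousOn_of_eq_zero (isOpen_univ.prod e.open_target)
    (isClosed_univ.prod hK.isClosed) (prod_mono_right hKe) ?_ fun q hq => ?_
  · exact (F.2.1.continuous.comp continuous_snd).continuousOn.clm_apply
      (contMDiffOn_chartRep_translateForm k he hα).continuousOn
  · rw [F.2.2 q.2 fun h => hq ⟨mem_univ _, h⟩]
    rfl

theorem integrable_coefficient_apply (k : ℕ) [ChartedSpace (EuclideanSpace ℝ (Fin k)) G]
    [LieGroup (𝓡 k) ∞ G] [ContMDiffSMul (𝓡 k) (𝓡 n) ∞ G M]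
    (he : e ∈ IsManifold.maximalAtlas (𝓡 n) ∞ M) (hK : IsCompact K) (hKe : K ⊆ e.target)
    (F : coefficientsIn n m K) {α : FormField n M m} (hα : IsSmoothForm α) (g : G) :
    Integrable (fun z => F.1 z (chartRep e (translateForm g α) z)) := by
  refine Continuous.integrable_of_hasCompactSupport
    ((continuous_coefficient_apply k he hK hKe F hα).comp (Continuous.prodMk_right g))
    (HasCompactSupport.intro hK fun z hz => ?_)
  rw [F.2.2 z hz]
  rfl

theorem continuous_pairing_translateForm (k : ℕ) [ChartedSpace (EuclideanSpace ℝ (Fin k)) G]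
    [LieGroup (𝓡 k) ∞ G] [ContMDiffSMul (𝓡 k) (𝓡 n) ∞ G M]
    (he : e ∈ IsManifold.maximalAtlas (𝓡 n) ∞ M) (hK : IsCompact K) (hKe : K ⊆ e.target)
    (F : coefficientsIn n m K) {α : FormField n M m} (hα : IsSmoothForm α) :
    Continuous (fun g : G => pairing e F.1 (translateForm g α)) := by
  have : SecondCountableTopology G :=
    ChartedSpace.secondCountable_of_sigmaCompact (EuclideanSpace ℝ (Fin k)) G
  have h := continuous_parametric_integral_of_continuous (μ := (volume : Measure (Euc n)))
    (f := fun g z => F.1 z (chartRep e (translateForm g α) z))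
    (continuous_coefficient_apply (G := G) k he hK hKe F hα) hK
  refine h.congr fun g => setIntegral_eq_integral_of_forall_compl_eq_zero fun z hz => ?_
  rw [F.2.2 z hz]
  rfl

variable [MeasurableSpace G] [BorelSpace G] (μ : Measure G) [IsFiniteMeasure μ]

theorem integrable_pairing_translateForm (k : ℕ) [ChartedSpace (EuclideanSpace ℝ (Fin k)) G]
    [LieGroup (𝓡 k) ∞ G] [ContMDiffSMul (𝓡 k) (𝓡 n) ∞ G M]
    (he : e ∈ IsManifold.maximalAtlas (𝓡 n) ∞ M) (hK : IsCompact K) (hKe : K ⊆ e.target)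
    (F : coefficientsIn n m K) {α : FormField n M m} (hα : IsSmoothForm α) :
    Integrable (fun g : G => pairing e F.1 (translateForm g α)) μ :=
  (continuous_pairing_translateForm k he hK hKe F hα).integrable_of_hasCompactSupport
    (HasCompactSupport.of_compactSpace _)

/-- The average over `G` of the pairings with the translates of a form. -/
def averagedPairing (e : OpenPartialHomeomorph M (Euc n)) (F : Euc n → Alt n m →L[ℝ] ℝ)
    (α : FormField n M m) : ℝ := ∫ g : G, pairing e F (translateForm g α) ∂μ

theorem averagedPairing_add_right (k : ℕ) [ChartedSpace (EuclideanSpace ℝ (Fin k)) G]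
    [LieGroup (𝓡 k) ∞ G] [ContMDiffSMul (𝓡 k) (𝓡 n) ∞ G M]
    (he : e ∈ IsManifold.maximalAtlas (𝓡 n) ∞ M) (hK : IsCompact K) (hKe : K ⊆ e.target)
    (F : coefficientsIn n m K) {α β : FormField n M m} (hα : IsSmoothForm α)
    (hβ : IsSmoothForm β) : averagedPairing μ e F.1 (α + β) =
      averagedPairing μ e F.1 α + averagedPairing μ e F.1 β := by
  rw [averagedPairing, averagedPairing, averagedPairing,
    ← integral_add (integrable_pairing_translateForm μ k he hK hKe F hα)
      (integrable_pairing_translateForm μ k he hK hKe F hβ)]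
  refine integral_congr_ae (Eventually.of_forall fun g => ?_)
  change pairing e F.1 (translateForm g (α + β)) =
    pairing e F.1 (translateForm g α) + pairing e F.1 (translateForm g β)
  rw [pairing, pairing, pairing, ← integral_add (integrable_coefficient_apply k he hK hKe F hα g)
      (integrable_coefficient_apply k he hK hKe F hβ g)]
  exact integral_congr_ae (Eventually.of_forall fun z => map_add (F.1 z)
    (chartRep e (translateForm g α) z) (chartRep e (translateForm g β) z))

theorem averagedPairing_smul_right (F : Euc n → Alt n m →L[ℝ] ℝ) (c : ℝ) (α : FormField n M m) :
    averagedPairing μ e F (c • α) = c * averagedPairing μ e F α := by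
  rw [averagedPairing, averagedPairing, ← integral_const_mul]
  refine integral_congr_ae (Eventually.of_forall fun g => ?_)
  change pairing e F (translateForm g (c • α)) = c * pairing e F (translateForm g α)
  rw [pairing, pairing, ← integral_const_mul]
  exact integral_congr_ae (Eventually.of_forall fun z => map_smul (F z) c
    (chartRep e (translateForm g α) z))

theorem averagedPairing_add_left (k : ℕ) [ChartedSpace (EuclideanSpace ℝ (Fin k)) G]
    [LieGroup (𝓡 k) ∞ G] [ContMDiffSMul (𝓡 k) (𝓡 n) ∞ G M]
    (he : e ∈ IsManifold.maximalAtlas (𝓡 n) ∞ M) (hK : IsCompact K) (hKe : K ⊆ e.target)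
    (F₁ F₂ : coefficientsIn n m K) {α : FormField n M m} (hα : IsSmoothForm α) :
    averagedPairing μ e (F₁ + F₂).1 α =
      averagedPairing μ e F₁.1 α + averagedPairing μ e F₂.1 α := by
  rw [averagedPairing, averagedPairing, averagedPairing,
    ← integral_add (integrable_pairing_translateForm μ k he hK hKe F₁ hα)
      (integrable_pairing_translateForm μ k he hK hKe F₂ hα)]
  refine integral_congr_ae (Eventually.of_forall fun g => ?_)
  change pairing e (F₁.1 + F₂.1) (translateForm g α) =
    pairing e F₁.1 (translateForm g α) + pairing e F₂.1 (translateForm g α)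
  rw [pairing, pairing, pairing, ← integral_add (integrable_coefficient_apply k he hK hKe F₁ hα g)
      (integrable_coefficient_apply k he hK hKe F₂ hα g)]
  rfl

theorem averagedPairing_smul_left (F : Euc n → Alt n m →L[ℝ] ℝ) (c : ℝ) (α : FormField n M m) :
    averagedPairing μ e (c • F) α = c * averagedPairing μ e F α := by
  rw [averagedPairing, averagedPairing, ← integral_const_mul]
  refine integral_congr_ae (Eventually.of_forall fun g => ?_)
  change pairing e (c • F) (translateForm g α) = c * pairing e F (translateForm g α)
  rw [pairing, pairing, ← integral_const_mul]
  rfl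

/-- The average is bounded by the sup norm of the coefficients of the translates over `G × K`, times
a bound for `F`, the volume of `K` and the mass of `μ`. -/
theorem tendsto_averagedPairing (k : ℕ) [ChartedSpace (EuclideanSpace ℝ (Fin k)) G]
    [LieGroup (𝓡 k) ∞ G] [ContMDiffSMul (𝓡 k) (𝓡 n) ∞ G M]
    (he : e ∈ IsManifold.maximalAtlas (𝓡 n) ∞ M) (hK : IsCompact K) (hKe : K ⊆ e.target)
    (F : coefficientsIn n m K) {α : ℕ → testForms n M m} (hα : TendstoZero α) :
    Tendsto (fun j => averagedPairing μ e F.1 (α j).1) atTop (𝓝 0) := by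
  obtain ⟨C, hC0, hC⟩ := exists_bound_apply_of_isCompact hK F.2.1.continuous
  set A := C * volume.real K * μ.real univ with hA
  have hA0 : 0 ≤ A := by positivity
  rw [Metric.tendsto_nhds]
  intro c hc
  -- Dividing by `A + 1` rather than `A` covers `A = 0` and keeps the final inequality strict.
  have hu := Metric.tendstoUniformlyOn_iff.1
    (tendstoUniformlyOn_chartRep_translateForm (G := G) k he hK hKe hα) (c / (A + 1))
    (by positivity)
  filter_upwards [hu] with j hj
  rw [dist_zero_right]
  have h1 : ∀ g : G, ‖pairing e F.1 (translateForm g (α j).1)‖ ≤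
      C * (c / (A + 1)) * volume.real K := fun g => by
    rw [pairing, ← setIntegral_eq_integral_of_forall_compl_eq_zero (s := K) fun z hz => by
      rw [F.2.2 z hz]; rfl]
    refine norm_setIntegral_le_of_norm_le_const hK.measure_lt_top fun z hz => ?_
    have h2 := hj (g, z) ⟨mem_univ _, hz⟩
    rw [Pi.zero_apply, dist_zero_left] at h2
    exact (hC z hz _).trans (by gcongr)
  calc ‖averagedPairing μ e F.1 (α j).1‖ ≤ C * (c / (A + 1)) * volume.real K * μ.real univ :=
        norm_integral_le_of_norm_le_const (Eventually.of_forall h1)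
    _ = A * (c / (A + 1)) := by rw [hA]; ring
    _ < (A + 1) * (c / (A + 1)) := by gcongr; linarith
    _ = c := by field_simp

/-- The average over `G` of the current given by smooth coefficients supported in a chart. -/
def averagedCurrent (k : ℕ) [ChartedSpace (EuclideanSpace ℝ (Fin k)) G]
    [LieGroup (𝓡 k) ∞ G] [ContMDiffSMul (𝓡 k) (𝓡 n) ∞ G M]
    (he : e ∈ IsManifold.maximalAtlas (𝓡 n) ∞ M) (hK : IsCompact K) (hKe : K ⊆ e.target) :
    coefficientsIn n m K →ₗ[ℝ] currents n m M where
  toFun F := ⟨{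
    toFun := fun α => averagedPairing μ e F.1 α.1
    map_add' := fun α β => averagedPairing_add_right μ k he hK hKe F α.2.1 β.2.1
    map_smul' := fun c α => averagedPairing_smul_right μ F.1 c α.1 },
    fun _ hα => tendsto_averagedPairing μ k he hK hKe F hα⟩
  map_add' F₁ F₂ := Subtype.ext (LinearMap.ext fun α =>
    averagedPairing_add_left μ k he hK hKe F₁ F₂ α.2.1)
  map_smul' c F := Subtype.ext (LinearMap.ext fun α => averagedPairing_smul_left μ F.1 c α.1)

/-- Pullback is contravariant, so the order of the factors is reversed. -/
theorem translateForm_translateForm (k : ℕ) [ChartedSpace (EuclideanSpace ℝ (Fin k)) G]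
    [ContMDiffSMul (𝓡 k) (𝓡 n) ∞ G M] (g h : G) (α : FormField n M m) :
    translateForm g (translateForm h α) = translateForm (h * g) α := by
  funext x
  have hne : (∞ : ℕ∞ω) ≠ 0 := by simp
  have h1 : mfderiv (𝓡 n) (𝓡 n) (fun x : M => h • g • x) x =
      (mfderiv (𝓡 n) (𝓡 n) (fun x : M => h • x) (g • x)).comp
        (mfderiv (𝓡 n) (𝓡 n) (fun x : M => g • x) x) :=
    mfderiv_comp (g := fun x : M => h • x) x
      ((ContMDiffSMul.contMDiff_const_smul (I := 𝓡 k) (n := ∞) h).contMDiffAt.mdifferentiableAt hne)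
      ((ContMDiffSMul.contMDiff_const_smul (I := 𝓡 k) (n := ∞) g).contMDiffAt.mdifferentiableAt hne)
  have h2 : (fun x : M => h • g • x) = fun x : M => (h * g) • x :=
    funext fun x => (mul_smul h g x).symm
  rw [h2] at h1
  ext v
  refine apply_congr_point α (mul_smul h g x).symm (funext fun i => ?_)
  exact (DFunLike.congr_fun h1 (v i)).symm

/-- Translating the form by `h` replaces `g` by `h * g` in the integrand, which left invariance of
`μ` absorbs. -/
theorem isInvariantCurrent_averagedCurrent [μ.IsMulLeftInvariant] (k : ℕ)
    [ChartedSpace (EuclideanSpace ℝ (Fin k)) G]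
    [LieGroup (𝓡 k) ∞ G] [ContMDiffSMul (𝓡 k) (𝓡 n) ∞ G M]
    (he : e ∈ IsManifold.maximalAtlas (𝓡 n) ∞ M) (hK : IsCompact K) (hKe : K ⊆ e.target)
    (F : coefficientsIn n m K) :
    IsInvariantCurrent k G (averagedCurrent μ k he hK hKe F) := by
  have : IsTopologicalGroup G := topologicalGroup_of_lieGroup (𝓡 k) ∞
  intro h
  ext α
  change ∫ g : G, pairing e F.1 (translateForm g (translateForm h α.1)) ∂μ =
    ∫ g : G, pairing e F.1 (translateForm g α.1) ∂μ
  simp only [translateForm_translateForm k]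
  exact integral_mul_left_eq_self (fun g => pairing e F.1 (translateForm g α.1)) h

end Average

/-! ### The averaged current has smooth coefficients -/

section Smoothness

variable {n m : ℕ} {G : Type*} [TopologicalSpace G] [Group G]
  {M : Type*} [TopologicalSpace M] [ChartedSpace (EuclideanSpace ℝ (Fin n)) M]
  [IsManifold (𝓡 n) ∞ M] [MulAction G M]
  {e e' : OpenPartialHomeomorph M (Euc n)} {K : Set (Euc n)}

theorem actionRep_inv_mem {g : G} {y : Euc n} (h : (g⁻¹, y) ∈ actionDomain G e' e) :
    (g, actionRep e' e g⁻¹ y) ∈ actionDomain G e e' := by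
  refine ⟨e.map_source h.2, ?_⟩
  change g • e.symm (e (g⁻¹ • e'.symm y)) ∈ e'.source
  rw [e.left_inv h.2, smul_inv_smul]
  exact e'.map_target h.1

theorem actionRep_actionRep_inv {g : G} {y : Euc n} (h : (g⁻¹, y) ∈ actionDomain G e' e) :
    actionRep e e' g (actionRep e' e g⁻¹ y) = y := by
  change e' (g • e.symm (e (g⁻¹ • e'.symm y))) = y
  rw [e.left_inv h.2, smul_inv_smul]
  exact e'.right_inv h.1

theorem differentiableAt_actionRep (k : ℕ) [ChartedSpace (EuclideanSpace ℝ (Fin k)) G]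
    [LieGroup (𝓡 k) ∞ G] [ContMDiffSMul (𝓡 k) (𝓡 n) ∞ G M]
    (he : e ∈ IsManifold.maximalAtlas (𝓡 n) ∞ M) (he' : e' ∈ IsManifold.maximalAtlas (𝓡 n) ∞ M)
    {g : G} {y : Euc n} (h : (g, y) ∈ actionDomain G e e') :
    DifferentiableAt ℝ (actionRep e e' g) y :=
  (contDiffAt_of_contMDiffAt_prod (q := (g, y))
    (contMDiffAt_actionRep k he he' h)).differentiableAt (by simp)

theorem isOpen_actionDomain_slice (k : ℕ) [ChartedSpace (EuclideanSpace ℝ (Fin k)) G]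
    [LieGroup (𝓡 k) ∞ G] [ContMDiffSMul (𝓡 k) (𝓡 n) ∞ G M]
    (he : e ∈ IsManifold.maximalAtlas (𝓡 n) ∞ M) (e' : OpenPartialHomeomorph M (Euc n)) (g : G) :
    IsOpen {y | (g, y) ∈ actionDomain G e e'} :=
  (isOpen_actionDomain k he e').preimage (Continuous.prodMk_right g)

/-- The map has a differentiable left inverse near `y`, given by the action of `g`. Nonvanishing is
needed because the absolute value of the Jacobian is smooth only away from zero. -/
theorem det_fderiv_actionRep_ne_zero (k : ℕ) [ChartedSpace (EuclideanSpace ℝ (Fin k)) G]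
    [LieGroup (𝓡 k) ∞ G] [ContMDiffSMul (𝓡 k) (𝓡 n) ∞ G M]
    (he : e ∈ IsManifold.maximalAtlas (𝓡 n) ∞ M) (he' : e' ∈ IsManifold.maximalAtlas (𝓡 n) ∞ M)
    {g : G} {y : Euc n} (h : (g⁻¹, y) ∈ actionDomain G e' e) :
    (fderiv ℝ (actionRep e' e g⁻¹) y).det ≠ 0 := by
  have h1 := (differentiableAt_actionRep k he he' (actionRep_inv_mem h)).hasFDerivAt.comp y
    (differentiableAt_actionRep k he' he h).hasFDerivAt
  have h2 : actionRep e e' g ∘ actionRep e' e g⁻¹ =ᶠ[𝓝 y] id := by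
    filter_upwards [(isOpen_actionDomain_slice k he' e g⁻¹).mem_nhds h] with z hz
    exact actionRep_actionRep_inv hz
  have h3 := h1.unique (h2.hasFDerivAt_iff.2 (hasFDerivAt_id y))
  intro h0
  have h4 : ((fderiv ℝ (actionRep e e' g) (actionRep e' e g⁻¹ y)).comp
      (fderiv ℝ (actionRep e' e g⁻¹) y)).det = 0 := by
    rw [ContinuousLinearMap.det, ContinuousLinearMap.toLinearMap_comp, LinearMap.det_comp]
    exact mul_eq_zero_of_right _ h0
  rw [h3] at h4
  simp [ContinuousLinearMap.det] at h4

open Classical in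
/-- The coefficients in the chart `e'` of the image under the group element `g` of the current
with coefficients `F` in the chart `e`. -/
def pushedCoefficient (e e' : OpenPartialHomeomorph M (Euc n)) (F : Euc n → Alt n m →L[ℝ] ℝ)
    (g : G) (y : Euc n) : Alt n m →L[ℝ] ℝ :=
  if (g⁻¹, y) ∈ actionDomain G e' e then
    |(fderiv ℝ (actionRep e' e g⁻¹) y).det| • (F (actionRep e' e g⁻¹ y)).comp
      (ContinuousAlternatingMap.compContinuousLinearMapCLM
        (fderiv ℝ (actionRep e e' g) (actionRep e' e g⁻¹ y)))
  else 0

theorem pushedCoefficient_of_mem {F : Euc n → Alt n m →L[ℝ] ℝ} {g : G} {y : Euc n}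
    (h : (g⁻¹, y) ∈ actionDomain G e' e) : pushedCoefficient e e' F g y =
      |(fderiv ℝ (actionRep e' e g⁻¹) y).det| • (F (actionRep e' e g⁻¹ y)).comp
        (ContinuousAlternatingMap.compContinuousLinearMapCLM
          (fderiv ℝ (actionRep e e' g) (actionRep e' e g⁻¹ y))) := if_pos h

theorem pushedCoefficient_of_notMem {F : Euc n → Alt n m →L[ℝ] ℝ} {g : G} {y : Euc n}
    (h : (g⁻¹, y) ∉ actionDomain G e' e) : pushedCoefficient e e' F g y = 0 := if_neg h

/-- Where `g⁻¹` maps into the chart `e`, every factor is jointly smooth. Elsewhere the image under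
`g⁻¹` avoids the closed set `e.symm '' K`, so the coefficient vanishes nearby. -/
theorem contMDiffOn_pushedCoefficient [T2Space M] (k : ℕ)
    [ChartedSpace (EuclideanSpace ℝ (Fin k)) G]
    [LieGroup (𝓡 k) ∞ G] [ContMDiffSMul (𝓡 k) (𝓡 n) ∞ G M]
    (he : e ∈ IsManifold.maximalAtlas (𝓡 n) ∞ M) (he' : e' ∈ IsManifold.maximalAtlas (𝓡 n) ∞ M)
    (hK : IsCompact K) (hKe : K ⊆ e.target) (F : coefficientsIn n m K) :
    ContMDiffOn ((𝓡 k).prod (𝓡 n)) 𝓘(ℝ, Alt n m →L[ℝ] ℝ) ∞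
      (Function.uncurry (pushedCoefficient (G := G) e e' F.1)) (univ ×ˢ e'.target) := by
  intro q hq
  refine ContMDiffAt.contMDiffWithinAt ?_
  have hinv : ContMDiff ((𝓡 k).prod (𝓡 n)) ((𝓡 k).prod (𝓡 n)) ∞
      (fun q : G × Euc n => (q.1⁻¹, q.2)) :=
    ((contMDiff_inv (𝓡 k) ∞).comp contMDiff_fst).prodMk contMDiff_snd
  by_cases hqd : (q.1⁻¹, q.2) ∈ actionDomain G e' e
  · have hτ : ContMDiffAt ((𝓡 k).prod (𝓡 n)) (𝓡 n) ∞
        (fun q : G × Euc n => actionRep e' e q.1⁻¹ q.2) q :=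
      ContMDiffAt.comp q (f := fun q : G × Euc n => (q.1⁻¹, q.2))
        (contMDiffAt_actionRep k he' he hqd) hinv.contMDiffAt
    have hDτ : ContMDiffAt ((𝓡 k).prod (𝓡 n)) 𝓘(ℝ, Euc n →L[ℝ] Euc n) ∞
        (fun q : G × Euc n => fderiv ℝ (actionRep e' e q.1⁻¹) q.2) q :=
      ContMDiffAt.comp q (f := fun q : G × Euc n => (q.1⁻¹, q.2))
        (contMDiffAt_fderiv_actionRep k he' he hqd) hinv.contMDiffAt
    have hdet : ContMDiffAt ((𝓡 k).prod (𝓡 n)) 𝓘(ℝ, ℝ) ∞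
        (fun q : G × Euc n => |(fderiv ℝ (actionRep e' e q.1⁻¹) q.2).det|) q :=
      ((contDiffAt_abs (det_fderiv_actionRep_ne_zero k he he' hqd)).comp _
        (contDiff_continuousLinearMap_det n).contDiffAt).contMDiffAt.comp q hDτ
    have hDσ : ContMDiffAt ((𝓡 k).prod (𝓡 n)) 𝓘(ℝ, Euc n →L[ℝ] Euc n) ∞
        (fun q : G × Euc n => fderiv ℝ (actionRep e e' q.1) (actionRep e' e q.1⁻¹ q.2)) q :=
      ContMDiffAt.comp q (f := fun q : G × Euc n => (q.1, actionRep e' e q.1⁻¹ q.2))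
        (contMDiffAt_fderiv_actionRep k he he' (actionRep_inv_mem hqd))
        (contMDiffAt_fst.prodMk hτ)
    have hC : ContMDiffAt ((𝓡 k).prod (𝓡 n)) 𝓘(ℝ, Alt n m →L[ℝ] Alt n m) ∞
        (fun q : G × Euc n => (ContinuousAlternatingMap.compContinuousLinearMapCLM
          (fderiv ℝ (actionRep e e' q.1) (actionRep e' e q.1⁻¹ q.2)) :
            Alt n m →L[ℝ] Alt n m)) q :=
      ContMDiffAt.comp q (contDiff_compContinuousLinearMapCLM n m).contMDiff.contMDiffAt hDσ
    have hF : ContMDiffAt ((𝓡 k).prod (𝓡 n)) 𝓘(ℝ, Alt n m →L[ℝ] ℝ) ∞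
        (fun q : G × Euc n => F.1 (actionRep e' e q.1⁻¹ q.2)) q :=
      ContMDiffAt.comp q F.2.1.contMDiff.contMDiffAt hτ
    refine ContMDiffAt.congr_of_eventuallyEq (hdet.smul (I := 𝓘(ℝ, ℝ)) (hF.clm_comp hC)) ?_
    filter_upwards [hinv.continuous.continuousAt.preimage_mem_nhds
      ((isOpen_actionDomain k he' e).mem_nhds hqd)] with p hp
    exact if_pos hp
  · refine (contMDiffAt_const (c := (0 : Alt n m →L[ℝ] ℝ))).congr_of_eventuallyEq ?_
    have hact : ContinuousAt (fun q : G × Euc n => q.1⁻¹ • e'.symm q.2) q :=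
      ContinuousAt.comp (f := fun q : G × Euc n => (q.1⁻¹, q.2))
        (g := fun q : G × Euc n => q.1 • e'.symm q.2)
        ((contMDiffOn_smul_symm k he').continuousOn.continuousAt
          ((isOpen_univ.prod e'.open_target).mem_nhds ⟨mem_univ _, hq.2⟩))
        hinv.continuous.continuousAt
    have hnot : q.1⁻¹ • e'.symm q.2 ∉ e.symm '' K := by
      rintro ⟨z, hz, hzq⟩
      exact hqd ⟨hq.2, hzq ▸ e.map_target (hKe hz)⟩
    filter_upwards [hact.preimage_mem_nhds
      ((isCompact_symm_image hK hKe).isClosed.isOpen_compl.mem_nhds hnot)] with p hp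
    change pushedCoefficient e e' F.1 p.1 p.2 = 0
    rw [pushedCoefficient]
    split_ifs with h
    · rw [F.2.2 (actionRep e' e p.1⁻¹ p.2) fun h' => hp ⟨_, h', e.left_inv h.2⟩]
      ext a
      simp
    · rfl

/-- The change of variables formula for the pairing with a translated form. -/
theorem pairing_translateForm (k : ℕ) [ChartedSpace (EuclideanSpace ℝ (Fin k)) G]
    [LieGroup (𝓡 k) ∞ G] [ContMDiffSMul (𝓡 k) (𝓡 n) ∞ G M]
    (he : e ∈ IsManifold.maximalAtlas (𝓡 n) ∞ M) (he' : e' ∈ IsManifold.maximalAtlas (𝓡 n) ∞ M)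
    (hKe : K ⊆ e.target) (F : coefficientsIn n m K) {α : FormField n M m}
    (hα : ∀ x ∉ e'.source, α x = 0) (g : G) :
    pairing e F.1 (translateForm g α) =
      ∫ y in e'.target, pushedCoefficient e e' F.1 g y (chartRep e' α y) := by
  set V := {y | (g⁻¹, y) ∈ actionDomain G e' e} with hVdef
  have hV : IsOpen V := isOpen_actionDomain_slice k he' e g⁻¹
  have hinj : InjOn (actionRep e' e g⁻¹) V := fun y hy z hz hyz => by
    rw [← actionRep_actionRep_inv hy, ← actionRep_actionRep_inv hz, hyz]
  have himage : actionRep e' e g⁻¹ '' V = {z | (g, z) ∈ actionDomain G e e'} := by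
    refine Subset.antisymm (image_subset_iff.2 fun y hy => actionRep_inv_mem hy) fun z hz => ?_
    have hz' : (g⁻¹⁻¹, z) ∈ actionDomain G e e' := by rwa [inv_inv]
    have h1 := actionRep_inv_mem hz'
    have h2 := actionRep_actionRep_inv hz'
    rw [inv_inv] at h1 h2
    exact ⟨actionRep e e' g z, h1, h2⟩
  -- Outside the image of `V`, either `g` carries the point out of `e'.source`, where `α` vanishes,
  -- or the point lies outside `e.target`, where `F` does.
  have h1 : pairing e F.1 (translateForm g α) =
      ∫ z in actionRep e' e g⁻¹ '' V, F.1 z (chartRep e (translateForm g α) z) := by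
    refine (setIntegral_eq_integral_of_forall_compl_eq_zero fun z hz => ?_).symm
    rw [himage] at hz
    by_cases hze : z ∈ e.target
    · have h0 : chartRep e (translateForm g α) z = 0 := by
        refine chartRep_eq_zero ?_
        have h0' : α (g • e.symm z) = 0 := hα _ fun h => hz ⟨hze, h⟩
        rw [translateForm, pullbackField, h0']
        ext v
        rfl
      rw [h0, map_zero]
    · rw [F.2.2 z fun h => hze (hKe h)]
      rfl
  rw [h1, integral_image_eq_integral_abs_det_fderiv_smul volume hV.measurableSet
    (fun y hy => (differentiableAt_actionRep k he' he hy).hasFDerivAt.hasFDerivWithinAt) hinj]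
  have h2 : ∀ y ∈ V, |(fderiv ℝ (actionRep e' e g⁻¹) y).det| •
      F.1 (actionRep e' e g⁻¹ y) (chartRep e (translateForm g α) (actionRep e' e g⁻¹ y)) =
        pushedCoefficient e e' F.1 g y (chartRep e' α y) := fun y hy => by
    rw [chartRep_translateForm k he he' α (q := (g, actionRep e' e g⁻¹ y)) (actionRep_inv_mem hy),
      pushedCoefficient_of_mem hy, actionRep_actionRep_inv hy]
    rfl
  rw [setIntegral_congr_fun hV.measurableSet h2]
  refine (setIntegral_eq_of_subset_of_forall_sdiff_eq_zero e'.open_target.measurableSet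
    (fun y hy => hy.1) fun y hy => ?_).symm
  rw [pushedCoefficient_of_notMem hy.2]
  rfl

/-- After the change of variables and Fubini, the coefficients are the `G`-averages of the pushed
coefficients, smooth by differentiation under the integral. -/
theorem isSmoothCurrent_averagedCurrent [CompactSpace G] [T2Space G] [MeasurableSpace G]
    [BorelSpace G] (μ : Measure G) [IsFiniteMeasure μ] [T2Space M] (k : ℕ)
    [ChartedSpace (EuclideanSpace ℝ (Fin k)) G]
    [LieGroup (𝓡 k) ∞ G] [ContMDiffSMul (𝓡 k) (𝓡 n) ∞ G M]
    (he : e ∈ IsManifold.maximalAtlas (𝓡 n) ∞ M) (hK : IsCompact K) (hKe : K ⊆ e.target)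
    (F : coefficientsIn n m K) :
    IsSmoothCurrent (averagedCurrent μ k he hK hKe F) := by
  intro e' he'
  have : IsManifold (𝓡 k) ∞ G := LieGroup.toContMDiffMul.toIsManifold
  have hH := contMDiffOn_pushedCoefficient (G := G) k he he' hK hKe F
  have hS : SmoothFamilyOn (pushedCoefficient (G := G) e e' F.1) e'.target :=
    smoothFamilyOn_of_contMDiffOn e'.open_target hH
  refine ⟨fun y => ∫ g in univ, pushedCoefficient e e' F.1 g y ∂μ,
    hS.contDiffOn_integral μ e'.open_target isCompact_univ, fun α hα => ?_⟩
  have hα0 : ∀ x ∉ e'.source, α.1 x = 0 := fun x hx => notMem_formSupport fun h => hx (hα h)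
  -- Extended by zero, the integrand is continuous with compact support on `G × ℝⁿ`, which is what
  -- the exchange of integrals uses.
  let j : G → Euc n → ℝ := fun g => e'.target.indicator fun y =>
    pushedCoefficient e e' F.1 g y (chartRep e' α.1 y)
  let K' := e' '' formSupport α.1
  have hK' : IsCompact K' := α.2.2.image_of_continuousOn (e'.continuousOn.mono hα)
  have hKe' : K' ⊆ e'.target := image_subset_iff.2 fun x hx => e'.map_source (hα hx)
  have hj0 : ∀ q : G × Euc n, q ∉ univ ×ˢ K' → j q.1 q.2 = 0 := by
    intro q hq
    by_cases hy : q.2 ∈ e'.target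
    · have h0 : chartRep e' α.1 q.2 = 0 := chartRep_eq_zero <| notMem_formSupport fun h =>
        hq ⟨mem_univ _, _, h, e'.right_inv hy⟩
      simp only [j, indicator_of_mem hy, h0, map_zero]
    · exact indicator_of_notMem hy _
  have hjc : Continuous (Function.uncurry j) := by
    refine continuous_of_continuousOn_of_eq_zero (isOpen_univ.prod e'.open_target)
      (isClosed_univ.prod hK'.isClosed) (prod_mono_right hKe') ?_ hj0
    refine (hS.continuousOn_uncurry.clm_apply (g := fun q : G × Euc n => chartRep e' α.1 q.2)
      ((α.2.1 e' he').continuousOn.comp continuousOn_snd fun q hq => hq.2)).congr fun q hq => ?_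
    exact indicator_of_mem (f := fun y => pushedCoefficient e e' F.1 q.1 y (chartRep e' α.1 y)) hq.2
  have hjs : HasCompactSupport (Function.uncurry j) :=
    HasCompactSupport.intro (isCompact_univ.prod hK') hj0
  calc averagedPairing μ e F.1 α.1 = ∫ g : G, (∫ y, j g y) ∂μ := by
        refine integral_congr_ae (Eventually.of_forall fun g => ?_)
        exact (pairing_translateForm k he he' hKe F hα0 g).trans
          (integral_indicator e'.open_target.measurableSet).symm
    _ = ∫ y, (∫ g : G, j g y ∂μ) := integral_integral_swap_of_hasCompactSupport hjc hjs
    _ = ∫ y, e'.target.indicator (fun y =>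
          (∫ g in univ, pushedCoefficient e e' F.1 g y ∂μ) (chartRep e' α.1 y)) y := by
        refine integral_congr_ae (Eventually.of_forall fun y => ?_)
        by_cases hy : y ∈ e'.target
        · simp only [j, indicator_of_mem hy]
          rw [ContinuousLinearMap.integral_apply, setIntegral_univ]
          exact (hS.continuous_left hy).continuousOn.integrableOn_compact isCompact_univ
        · simp only [j, indicator_of_notMem hy, integral_zero]
    _ = _ := integral_indicator e'.open_target.measurableSet

end Smoothness

/-! ### Moving a functional on jets through integrals -/

section Functionals

universe u

/-- A continuous linear functional on continuous functions commutes with the integral of a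
compactly supported continuous family. -/
theorem exists_integral_eq_apply {E X J : Type*} [TopologicalSpace E] [MeasurableSpace E]
    [OpensMeasurableSpace E] [SecondCountableTopology E] [T2Space E] (μ : Measure E)
    [IsFiniteMeasureOnCompacts μ] [TopologicalSpace X] [CompactSpace X] [NormedAddCommGroup J]
    [NormedSpace ℝ J] [CompleteSpace J] {K : Set E} (hK : IsCompact K) (Φ : C(X, J) →L[ℝ] ℝ)
    {H : E × X → J} (hH : Continuous H) (h0 : ∀ z ∉ K, ∀ x, H (z, x) = 0) :
    ∃ I : C(X, J), ∫ z, Φ ⟨fun x => H (z, x), hH.comp (Continuous.prodMk_right z)⟩ ∂μ = Φ I ∧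
      ∀ x, I x = ∫ z, H (z, x) ∂μ := by
  let h : E → C(X, J) := fun z => ⟨fun x => H (z, x), hH.comp (Continuous.prodMk_right z)⟩
  have hc : Continuous h := ContinuousMap.continuous_of_continuous_uncurry _ hH
  have hi : Integrable h μ := hc.integrable_of_hasCompactSupport
    (HasCompactSupport.intro hK fun z hz => by ext1 x; exact h0 z hz x)
  refine ⟨∫ z, h z ∂μ, Φ.integral_comp_comm hi, fun x => ?_⟩
  rw [ContinuousMap.integral_apply hi]
  rfl

theorem exists_bound_functional {X J : Type*} [TopologicalSpace X] [CompactSpace X]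
    [NormedAddCommGroup J] [NormedSpace ℝ J] (Φ : C(X, J) →L[ℝ] ℝ) :
    ∃ A : ℝ, 0 ≤ A ∧ ∀ (I : C(X, J)) (B : ℝ), 0 ≤ B → (∀ x, ‖I x‖ ≤ B) → |Φ I| ≤ A * B :=
  ⟨‖Φ‖, norm_nonneg _, fun I _ hB h => Φ.le_opNorm_of_le ((ContinuousMap.norm_le I hB).2 h)⟩

/-- A continuous linear functional of the jets of a superposition of translates of `φ`. -/
theorem exists_integral_jet_eq {E F : Type} [NormedAddCommGroup E] [NormedSpace ℝ E]
    [FiniteDimensional ℝ E] [MeasurableSpace E] [BorelSpace E] [NormedAddCommGroup F]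
    [NormedSpace ℝ F] [CompleteSpace F] (μ : Measure E) [μ.IsAddHaarMeasure] (r : ℕ) {L : Set E}
    [CompactSpace L] (Φ : C(L, Jet E F r) →L[ℝ] ℝ) {φ : E → ℝ} (hφ : ContDiff ℝ ∞ φ)
    (hφc : HasCompactSupport φ) {v : E → F} (hv : ContDiff ℝ ∞ v) (hvc : HasCompactSupport v) :
    ∃ (H : E → C(L, Jet E F r)) (J : C(L, Jet E F r)),
      (∀ z x, H z x = jet r (fun x => φ (x - z) • v z) x) ∧ ∫ z, Φ (H z) ∂μ = Φ J ∧
      ∀ x, J x = ∫ z, φ z • jet r v (x - z) ∂μ := by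
  have : ProperSpace E := FiniteDimensional.proper ℝ E
  have hfam : SmoothFamilyOn (fun z x => φ (x - z) • v z) univ :=
    smoothFamilyOn_of_contDiff ((hφ.comp (contDiff_snd.sub contDiff_fst)).smul
      (hv.comp contDiff_fst))
  have hjc : Continuous fun q : E × E => jet r (fun x => φ (x - q.1) • v q.1) q.2 :=
    continuous_pi fun j => by
      have := hfam.continuousOn j
      rwa [univ_prod_univ, continuousOn_univ] at this
  have hH : Continuous fun p : E × L => jet r (fun x => φ (x - p.1) • v p.1) (p.2 : E) :=
    hjc.comp (f := fun p : E × L => (p.1, (p.2 : E))) (by fun_prop)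
  obtain ⟨J, hJ, hJx⟩ := exists_integral_eq_apply μ hvc Φ hH fun z hz x => by
    rw [image_eq_zero_of_notMem_tsupport hz]
    simp only [smul_zero]
    exact jet_eq_zero r (by simp [tsupport])
  exact ⟨_, J, fun z x => rfl, hJ, fun x =>
    (hJx x).trans (integral_jet_smul μ r hφ hφc hv hvc x)⟩

theorem contDiff_comp_translates {E F : Type u} [NormedAddCommGroup E] [NormedSpace ℝ E]
    [NormedAddCommGroup F] [NormedSpace ℝ F] {L : Set E} [CompactSpace L] (Φ : C(L, F) →L[ℝ] ℝ)
    {ψ : C(E, F)} (hψ : ContDiff ℝ ∞ ψ) : ContDiff ℝ ∞ fun z => Φ (translates L ψ z) :=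
  Φ.contDiff.comp (contDiff_translates L hψ)

end Functionals

/-! ### Mollifying a current in a chart -/

section Regularization

variable {n m : ℕ} {M : Type*} [TopologicalSpace M] [ChartedSpace (EuclideanSpace ℝ (Fin n)) M]
  [IsManifold (𝓡 n) ∞ M] {e : OpenPartialHomeomorph M (Euc n)}

/-- A smooth cutoff function `ρ` in the chart `e`, supported in a compact set `K` whose closed
`δ`-neighbourhood lies in a compact subset `L` of the chart. -/
structure Cutoff (e : OpenPartialHomeomorph M (Euc n)) where
  mem : e ∈ IsManifold.maximalAtlas (𝓡 n) ∞ M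
  ρ : Euc n → ℝ
  contDiff : ContDiff ℝ ∞ ρ
  K : Set (Euc n)
  isCompact_K : IsCompact K
  eq_zero : ∀ y ∉ K, ρ y = 0
  L : Set (Euc n)
  isCompact_L : IsCompact L
  subset_target : L ⊆ e.target
  δ : ℝ
  δ_pos : 0 < δ
  closedBall_subset : ∀ z ∈ K, Metric.closedBall z δ ⊆ L

namespace Cutoff

variable (c : Cutoff e)

theorem K_subset_L : c.K ⊆ c.L := fun z hz =>
  c.closedBall_subset z hz (Metric.mem_closedBall_self c.δ_pos.le)

theorem K_subset_target : c.K ⊆ e.target := c.K_subset_L.trans c.subset_target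

theorem tsupport_subset : tsupport c.ρ ⊆ c.K :=
  closure_minimal (fun y hy => by_contra fun h => hy (c.eq_zero y h)) c.isCompact_K.isClosed

theorem bump_eq_zero {φ : ContDiffBump (0 : Euc n)} (hφ : φ.rOut ≤ c.δ) {z : Euc n} (hz : z ∈ c.K)
    {x : Euc n} (hx : x ∉ c.L) : φ.normed volume (x - z) = 0 := by
  by_contra h
  have h1 : x - z ∈ Metric.ball 0 φ.rOut := by
    rw [← φ.support_normed_eq (μ := volume)]
    exact h
  refine hx (c.closedBall_subset z hz ?_)
  rw [Metric.mem_closedBall, dist_eq_norm]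
  rw [mem_ball_zero_iff] at h1
  exact h1.le.trans hφ

/-- The form `φ (· - z) • a`, supported in the chart. -/
def bumpForm {φ : ContDiffBump (0 : Euc n)} (hφ : φ.rOut ≤ c.δ) {z : Euc n} (hz : z ∈ c.K) :
    Alt n m →ₗ[ℝ] smoothSupportedIn n m c.L where
  toFun a := ⟨fun x => φ.normed volume (x - z) • a,
    ((φ.contDiff_normed.comp (contDiff_id.sub contDiff_const)).smul contDiff_const),
    fun x hx => by
      change φ.normed volume (x - z) • a = 0
      rw [c.bump_eq_zero hφ hz hx, zero_smul]⟩
  map_add' a b := Subtype.ext (funext fun x => smul_add _ a b)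
  map_smul' t a := Subtype.ext (funext fun x => smul_comm _ t a)

variable [T2Space M]

open Classical in
/-- The coefficients of the convolution of the current `ρ T` with the mollifier `φ`. -/
def regularizedCoefficient {φ : ContDiffBump (0 : Euc n)} (hφ : φ.rOut ≤ c.δ)
    (T : currents n m M) (z : Euc n) : Alt n m →L[ℝ] ℝ :=
  if hz : z ∈ c.K then c.ρ z • LinearMap.toContinuousLinearMap
    (T.1 ∘ₗ testFormOf c.mem c.isCompact_L c.subset_target ∘ₗ c.bumpForm hφ hz) else 0

theorem regularizedCoefficient_apply_of_mem {φ : ContDiffBump (0 : Euc n)} (hφ : φ.rOut ≤ c.δ)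
    (T : currents n m M) {z : Euc n} (hz : z ∈ c.K) (a : Alt n m) :
    c.regularizedCoefficient hφ T z a =
      c.ρ z * T.1 (testFormOf c.mem c.isCompact_L c.subset_target (c.bumpForm hφ hz a)) := by
  rw [regularizedCoefficient, dif_pos hz]
  rfl

theorem regularizedCoefficient_of_notMem {φ : ContDiffBump (0 : Euc n)} (hφ : φ.rOut ≤ c.δ)
    (T : currents n m M) {z : Euc n} (hz : z ∉ c.K) : c.regularizedCoefficient hφ T z = 0 :=
  dif_neg hz

/-- In terms of the jet functional `Φ`, the coefficient is `ρ` times `Φ` of a translated jet. That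
expression is defined and smooth for every `z`, and `ρ` removes the points outside `K`. -/
theorem contDiff_regularizedCoefficient {φ : ContDiffBump (0 : Euc n)} (hφ : φ.rOut ≤ c.δ)
    (T : currents n m M) : ContDiff ℝ ∞ (c.regularizedCoefficient hφ T) := by
  have : CompactSpace c.L := isCompact_iff_compactSpace.1 c.isCompact_L
  obtain ⟨r, Φ, hΦ⟩ := exists_jet_functional c.mem c.isCompact_L c.subset_target T
  refine contDiff_clm_apply_iff.2 fun a => ?_
  have hs : ContDiff ℝ ∞ (jet r fun x => φ.normed volume x • a) :=
    contDiff_jet r (φ.contDiff_normed.smul contDiff_const)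
  have h : (fun z => c.regularizedCoefficient hφ T z a) =
      fun z => c.ρ z * Φ (translates c.L
        ⟨jet r fun x => φ.normed volume x • a, hs.continuous⟩ z) := by
    funext z
    by_cases hz : z ∈ c.K
    · rw [c.regularizedCoefficient_apply_of_mem hφ T hz, hΦ]
      congr 2
      ext1 x
      exact jet_comp_sub r (fun x => φ.normed volume x • a) z x
    · rw [c.regularizedCoefficient_of_notMem hφ T hz, c.eq_zero z hz, zero_mul]
      rfl
  rw [h]
  exact c.contDiff.mul (contDiff_comp_translates Φ (ψ := ⟨_, hs.continuous⟩) hs)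

/-- Regularization, as a linear operator on currents. -/
def regularize {φ : ContDiffBump (0 : Euc n)} (hφ : φ.rOut ≤ c.δ) :
    currents n m M →ₗ[ℝ] coefficientsIn n m c.K where
  toFun T := ⟨c.regularizedCoefficient hφ T, c.contDiff_regularizedCoefficient hφ T,
    fun _ hz => c.regularizedCoefficient_of_notMem hφ T hz⟩
  map_add' T S := by
    refine Subtype.ext (funext fun z => ContinuousLinearMap.ext fun a => ?_)
    change c.regularizedCoefficient hφ (T + S) z a =
      c.regularizedCoefficient hφ T z a + c.regularizedCoefficient hφ S z a
    by_cases hz : z ∈ c.K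
    · simp only [c.regularizedCoefficient_apply_of_mem hφ _ hz]
      exact mul_add _ _ _
    · simp [c.regularizedCoefficient_of_notMem hφ _ hz]
  map_smul' t T := by
    refine Subtype.ext (funext fun z => ContinuousLinearMap.ext fun a => ?_)
    change c.regularizedCoefficient hφ (t • T) z a = t * c.regularizedCoefficient hφ T z a
    by_cases hz : z ∈ c.K
    · simp only [c.regularizedCoefficient_apply_of_mem hφ _ hz]
      exact mul_left_comm _ _ _
    · simp [c.regularizedCoefficient_of_notMem hφ _ hz]

/-- The localization `ρ α` of a smooth form, expressed in the chart. -/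
def localize {α : FormField n M m} (hα : IsSmoothForm α) : smoothSupportedIn n m c.L :=
  ⟨fun y => c.ρ y • chartRep e α y,
    contDiff_smul_of_tsupport_subset e.open_target c.contDiff
      (c.tsupport_subset.trans c.K_subset_target) (hα e c.mem),
    fun y hy => by
      change c.ρ y • chartRep e α y = 0
      rw [c.eq_zero y fun h => hy (c.K_subset_L h), zero_smul]⟩

theorem localize_eq_zero {α : FormField n M m} (hα : IsSmoothForm α) {y : Euc n} (hy : y ∉ c.K) :
    (c.localize hα).1 y = 0 := by
  change c.ρ y • chartRep e α y = 0
  rw [c.eq_zero y hy, zero_smul]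

/-- By linearity `ρ(z)` and the form at `z` go inside `T`, and `Φ` commutes with the integral over
`z`. As `r` and `Φ` are chosen before `φ` and `α`, the resulting estimates are uniform in the
mollifier and, later, in the group element. -/
theorem exists_pairing_eq (T : currents n m M) [CompactSpace c.L] :
    ∃ r : ℕ, ∃ Φ : C(c.L, Jet (Euc n) (Alt n m) r) →L[ℝ] ℝ,
      (∀ u : smoothSupportedIn n m c.L,
        T.1 (testFormOf c.mem c.isCompact_L c.subset_target u) = Φ (jetOn n m r c.L u)) ∧
      ∀ (φ : ContDiffBump (0 : Euc n)) (hφ : φ.rOut ≤ c.δ) (α : FormField n M m)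
        (hα : IsSmoothForm α), ∃ J : C(c.L, Jet (Euc n) (Alt n m) r),
          pairing e (c.regularize hφ T).1 α = Φ J ∧
          ∀ x, J x = ∫ z, φ.normed volume z • jet r (c.localize hα).1 (x - z) := by
  obtain ⟨r, Φ, hΦ⟩ := exists_jet_functional c.mem c.isCompact_L c.subset_target T
  refine ⟨r, Φ, hΦ, fun φ hφ α hα => ?_⟩
  have hvs : ContDiff ℝ ∞ (c.localize hα).1 := (c.localize hα).2.1
  have hvc : HasCompactSupport (c.localize hα).1 := HasCompactSupport.intro c.isCompact_K
    fun y hy => c.localize_eq_zero hα hy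
  obtain ⟨H, J, hH, hJ, hJx⟩ := exists_integral_jet_eq (E := Euc n) (F := Alt n m) volume r Φ
    (φ := φ.normed volume) φ.contDiff_normed φ.hasCompactSupport_normed hvs hvc
  refine ⟨J, ?_, hJx⟩
  rw [← hJ]
  refine integral_congr_ae (Eventually.of_forall fun z => ?_)
  change c.regularizedCoefficient hφ T z (chartRep e α z) = Φ (H z)
  by_cases hz : z ∈ c.K
  · rw [c.regularizedCoefficient_apply_of_mem hφ T hz, ← smul_eq_mul, ← map_smul, ← map_smul,
      ← map_smul, hΦ]
    refine congrArg Φ ?_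
    ext1 x
    exact (hH z x).symm
  · rw [c.regularizedCoefficient_of_notMem hφ T hz]
    refine (map_zero Φ).symm.trans (congrArg Φ ?_)
    ext1 x
    rw [hH, c.localize_eq_zero hα hz]
    simp only [smul_zero]
    exact (jet_eq_zero r (by simp [tsupport])).symm

/-- The regularizations of a current are uniformly of finite order. -/
theorem exists_bound_pairing (T : currents n m M) :
    ∃ r : ℕ, ∃ A : ℝ, 0 ≤ A ∧
      (∀ (φ : ContDiffBump (0 : Euc n)) (hφ : φ.rOut ≤ c.δ) (α : FormField n M m)
        (hα : IsSmoothForm α) (B : ℝ), 0 ≤ B → (∀ x, ‖jet r (c.localize hα).1 x‖ ≤ B) →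
          |pairing e (c.regularize hφ T).1 α| ≤ A * B) ∧
      ∀ (φ : ContDiffBump (0 : Euc n)) (hφ : φ.rOut ≤ c.δ) (α : FormField n M m)
        (hα : IsSmoothForm α) (B : ℝ), 0 ≤ B →
        (∀ x, ‖(∫ z, φ.normed volume z • jet r (c.localize hα).1 (x - z)) -
          jet r (c.localize hα).1 x‖ ≤ B) →
          |pairing e (c.regularize hφ T).1 α -
            T.1 (testFormOf c.mem c.isCompact_L c.subset_target (c.localize hα))| ≤ A * B := by
  have : CompactSpace c.L := isCompact_iff_compactSpace.1 c.isCompact_L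
  obtain ⟨r, Φ, hΦ, h⟩ := c.exists_pairing_eq T
  obtain ⟨A, hA0, hA⟩ := exists_bound_functional Φ
  refine ⟨r, A, hA0, fun φ hφ α hα B hB0 hB => ?_, fun φ hφ α hα B hB0 hB => ?_⟩
  · obtain ⟨J, hJ, hJx⟩ := h φ hφ α hα
    rw [hJ]
    refine hA J B hB0 fun x => ?_
    rw [hJx]
    exact norm_integral_normed_smul_le volume φ hB x
  · obtain ⟨J, hJ, hJx⟩ := h φ hφ α hα
    rw [hJ, hΦ, ← map_sub]
    refine hA _ B hB0 fun x => ?_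
    change ‖J x - jet r (c.localize hα).1 x‖ ≤ B
    rw [hJx]
    exact hB x

/-- The mollified jets converge uniformly because the jet of `ρ α` is continuous with compact
support, and the functional on jets is bounded. -/
theorem tendsto_pairing_regularize (T : currents n m M) {ι : Type*} {l : Filter ι}
    {φ : ι → ContDiffBump (0 : Euc n)} (hφ : ∀ i, (φ i).rOut ≤ c.δ)
    (hφl : Tendsto (fun i => (φ i).rOut) l (𝓝 0)) {α : FormField n M m} (hα : IsSmoothForm α) :
    Tendsto (fun i => pairing e (c.regularize (hφ i) T).1 α) l
      (𝓝 (T.1 (testFormOf c.mem c.isCompact_L c.subset_target (c.localize hα)))) := by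
  obtain ⟨r, A, hA0, -, hA⟩ := c.exists_bound_pairing (m := m) T
  rw [Metric.tendsto_nhds]
  intro η hη
  have hvc : HasCompactSupport (c.localize hα).1 := HasCompactSupport.intro c.isCompact_K
    fun y hy => c.localize_eq_zero hα hy
  have hev := eventually_norm_integral_normed_smul_sub_le volume hφl
    (contDiff_jet r (c.localize hα).2.1).continuous (hasCompactSupport_jet r hvc)
    (c := η / (A + 1)) (by positivity)
  filter_upwards [hev] with i hi
  rw [Real.dist_eq]
  calc _ ≤ A * (η / (A + 1)) := hA (φ i) (hφ i) α hα _ (by positivity) hi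
    _ < (A + 1) * (η / (A + 1)) := by gcongr; linarith
    _ = η := by field_simp

end Cutoff

end Regularization

/-! ### Sums of smooth and of invariant currents -/

section Sums

variable {n m : ℕ} {M : Type*} [TopologicalSpace M] [ChartedSpace (EuclideanSpace ℝ (Fin n)) M]

theorem integrableOn_coefficient_apply [IsManifold (𝓡 n) ∞ M]
    {e : OpenPartialHomeomorph M (Euc n)} (he : e ∈ IsManifold.maximalAtlas (𝓡 n) ∞ M)
    {f : Euc n → Alt n m →L[ℝ] ℝ} (hf : ContDiffOn ℝ ∞ f e.target) (α : testForms n M m)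
    (hα : formSupport α.1 ⊆ e.source) :
    IntegrableOn (fun y => f y (chartRep e α.1 y)) e.target := by
  have hK : IsCompact (e '' formSupport α.1) := α.2.2.image_of_continuousOn (e.continuousOn.mono hα)
  have hKe : e '' formSupport α.1 ⊆ e.target := by
    rintro _ ⟨x, hx, rfl⟩
    exact e.map_source (hα hx)
  have h := ((hf.continuousOn.clm_apply (α.2.1 e he).continuousOn).mono hKe).integrableOn_compact
    (μ := volume) hK
  refine h.of_forall_sdiff_eq_zero e.open_target.measurableSet fun y hy => ?_
  have : α.1 (e.symm y) = 0 := notMem_formSupport fun h' =>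
    hy.2 ⟨e.symm y, h', e.right_inv hy.1⟩
  rw [chartRep_eq_zero this, map_zero]

theorem IsSmoothCurrent.zero : IsSmoothCurrent (0 : currents n m M) := fun _ _ =>
  ⟨fun _ => 0, contDiffOn_const, fun _ _ => integral_zero _ _ |>.symm⟩

theorem IsSmoothCurrent.add [IsManifold (𝓡 n) ∞ M] {T S : currents n m M} (hT : IsSmoothCurrent T)
    (hS : IsSmoothCurrent S) : IsSmoothCurrent (T + S) := by
  intro e he
  obtain ⟨f, hf, hTf⟩ := hT e he
  obtain ⟨g, hg, hSg⟩ := hS e he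
  refine ⟨fun y => f y + g y, hf.add hg, fun α hα => ?_⟩
  have h := integral_add (integrableOn_coefficient_apply he hf α hα)
    (integrableOn_coefficient_apply he hg α hα)
  refine Eq.trans ?_ h.symm
  rw [← hTf α hα, ← hSg α hα]
  rfl

variable {k : ℕ} {G : Type*} [TopologicalSpace G] [ChartedSpace (EuclideanSpace ℝ (Fin k)) G]
  [Group G] [MulAction G M] [IsManifold (𝓡 n) ∞ M] [ContMDiffSMul (𝓡 k) (𝓡 n) ∞ G M]

theorem IsInvariantCurrent.zero : IsInvariantCurrent k G (0 : currents n m M) := fun _ => rfl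

theorem IsInvariantCurrent.add {T S : currents n m M} (hT : IsInvariantCurrent k G T)
    (hS : IsInvariantCurrent k G S) : IsInvariantCurrent k G (T + S) := by
  intro g
  have h1 := hT g
  have h2 := hS g
  rw [pushforward] at *
  change (T.1 + S.1) ∘ₗ _ = T.1 + S.1
  rw [LinearMap.add_comp, h1, h2]

end Sums

/-! ### The local smoothing operators and the limit of their sums -/

section Smoothing

variable {n m : ℕ} {M : Type*} [TopologicalSpace M] [ChartedSpace (EuclideanSpace ℝ (Fin n)) M]
  [IsManifold (𝓡 n) ∞ M] {e : OpenPartialHomeomorph M (Euc n)}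

namespace Cutoff

variable (c : Cutoff e)

/-- A mollifier of radius at most `ε`, small enough for the cutoff `c`. -/
def bump (ε : ℝ) : ContDiffBump (0 : Euc n) where
  -- For `ε ≤ 0` the radius defaults to `δ`, so the bump is a legitimate mollifier for every real
  -- `ε`.
  rIn := (if 0 < ε then min ε c.δ else c.δ) / 2
  rOut := if 0 < ε then min ε c.δ else c.δ
  rIn_pos := by
    have := c.δ_pos
    split_ifs <;> positivity
  rIn_lt_rOut := by
    have := c.δ_pos
    refine half_lt_self ?_
    split_ifs <;> positivity

theorem rOut_bump_le (ε : ℝ) : (c.bump ε).rOut ≤ c.δ := by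
  change (if 0 < ε then min ε c.δ else c.δ) ≤ c.δ
  split_ifs
  · exact min_le_right _ _
  · exact le_rfl

theorem tendsto_rOut_bump : Tendsto (fun ε => (c.bump ε).rOut) (𝓝[>] 0) (𝓝 0) := by
  refine tendsto_of_tendsto_of_tendsto_of_le_of_le' tendsto_const_nhds
    (tendsto_id.mono_left nhdsWithin_le_nhds : Tendsto (fun ε : ℝ => ε) (𝓝[>] 0) (𝓝 0))
    (Eventually.of_forall fun ε => (c.bump ε).rOut_pos.le) ?_
  filter_upwards [self_mem_nhdsWithin] with ε hε
  change (if 0 < ε then min ε c.δ else c.δ) ≤ ε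
  rw [if_pos (mem_Ioi.1 hε)]
  exact min_le_left _ _

/-- A smooth function with compact support in a chart is a cutoff. -/
theorem exists_of_tsupport_subset [T2Space M] (he : e ∈ IsManifold.maximalAtlas (𝓡 n) ∞ M)
    {f : M → ℝ} (hf : ContMDiff (𝓡 n) 𝓘(ℝ) ∞ f) (hfc : HasCompactSupport f)
    (hfe : tsupport f ⊆ e.source) :
    ∃ c : Cutoff e, ∀ x ∈ e.source, c.ρ (e x) = f x := by
  have hK : IsCompact (e '' tsupport f) :=
    IsCompact.image_of_continuousOn hfc (e.continuousOn.mono hfe)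
  have hKe : e '' tsupport f ⊆ e.target := by
    rintro _ ⟨x, hx, rfl⟩
    exact e.map_source (hfe hx)
  have h0 : ∀ y ∉ e '' tsupport f, e.target.indicator (fun y => f (e.symm y)) y = 0 := by
    intro y hy
    by_cases h : y ∈ e.target
    · rw [indicator_of_mem h]
      exact image_eq_zero_of_notMem_tsupport fun h' => hy ⟨e.symm y, h', e.right_inv h⟩
    · exact indicator_of_notMem h _
  have hs : ContDiff ℝ ∞ (e.target.indicator fun y => f (e.symm y)) := by
    refine contDiff_of_contDiffOn_of_tsupport_subset e.open_target ?_
      ((closure_minimal (fun y hy => by_contra fun h => Function.mem_support.1 hy (h0 y h))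
        hK.isClosed).trans hKe)
    refine ContDiffOn.congr (f := fun y => f (e.symm y)) (fun y hy => ?_)
      fun y hy => indicator_of_mem hy _
    exact ((hf.contMDiffAt).comp y (contMDiffAt_symm_of_mem he hy)).contDiffAt.contDiffWithinAt
  -- The compact set `L` of the cutoff is the closed `δ`-thickening of the image of the support,
  -- leaving room for bumps of radius `δ`.
  obtain ⟨δ, hδ, hδe⟩ := hK.exists_cthickening_subset_open e.open_target hKe
  refine ⟨⟨he, _, hs, _, hK, h0, _, hK.cthickening, hδe, δ, hδ, fun z hz =>
    Metric.closedBall_subset_cthickening hz δ⟩, fun x hx => ?_⟩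
  change e.target.indicator (fun y => f (e.symm y)) (e x) = f x
  rw [indicator_of_mem (e.map_source hx), e.left_inv hx]

theorem formOf_localize [T2Space M] {α : FormField n M m} (hα : IsSmoothForm α) {f : M → ℝ}
    (hf : ∀ x ∈ e.source, c.ρ (e x) = f x) (hfe : ∀ x ∉ e.source, f x = 0) (x : M) :
    formOf e (c.localize hα).1 x = f x • α x := by
  by_cases hx : x ∈ e.source
  · rw [← hf x hx]
    exact formOf_chartRep c.mem c.ρ α hx
  · rw [formOf_of_notMem hx, hfe x hx, zero_smul]

theorem localize_eq_zero_of_forall [T2Space M] {α : FormField n M m} (hα : IsSmoothForm α)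
    (h : ∀ x ∈ e.source, c.ρ (e x) ≠ 0 → α x = 0) : (c.localize hα).1 = 0 := by
  funext y
  change c.ρ y • chartRep e α y = 0
  by_cases hy : c.ρ y = 0
  · rw [hy, zero_smul]
  · have hyt : y ∈ e.target := c.K_subset_target (by_contra fun h' => hy (c.eq_zero y h'))
    rw [chartRep_eq_zero (h _ (e.map_target hyt) (by rwa [e.right_inv hyt])), smul_zero]

variable {G : Type*} [TopologicalSpace G] [Group G] [MulAction G M] [CompactSpace G] [T2Space G]

/-- The localizations of the translates of a form are uniformly bounded with all derivatives. -/
theorem exists_bound_jet_localize [T2Space M] (k : ℕ)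
    [ChartedSpace (EuclideanSpace ℝ (Fin k)) G] [LieGroup (𝓡 k) ∞ G]
    [ContMDiffSMul (𝓡 k) (𝓡 n) ∞ G M] {α : FormField n M m} (hα : IsSmoothForm α) (r : ℕ) :
    ∃ B : ℝ, 0 ≤ B ∧ ∀ (g : G) (x : Euc n),
      ‖jet r (c.localize (isSmoothForm_translateForm k g hα)).1 x‖ ≤ B := by
  have : IsManifold (𝓡 k) ∞ G := LieGroup.toContMDiffMul.toIsManifold
  set H : G → Euc n → Alt n m := fun g y => c.ρ y • chartRep e (translateForm g α) y with hH
  have h0 : ∀ g, ∀ y ∉ c.K, H g y = 0 := fun g y hy => by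
    change c.ρ y • chartRep e (translateForm g α) y = 0
    rw [c.eq_zero y hy, zero_smul]
  have hs : ContMDiffOn ((𝓡 k).prod (𝓡 n)) 𝓘(ℝ, Alt n m) ∞ (Function.uncurry H)
      (univ ×ˢ univ) := by
    intro q _
    refine ContMDiffAt.contMDiffWithinAt ?_
    by_cases hq : q.2 ∈ c.K
    · have h1 := (contMDiffOn_chartRep_translateForm (G := G) k c.mem hα).contMDiffAt
        ((isOpen_univ.prod e.open_target).mem_nhds ⟨mem_univ q.1, c.K_subset_target hq⟩)
      have h2 : ContMDiffAt ((𝓡 k).prod (𝓡 n)) 𝓘(ℝ, ℝ) ∞ (fun q : G × Euc n => c.ρ q.2) q :=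
        c.contDiff.contMDiff.contMDiffAt.comp q contMDiffAt_snd
      exact h2.smul h1
    · refine (contMDiffAt_const (c := (0 : Alt n m))).congr_of_eventuallyEq ?_
      filter_upwards [(c.isCompact_K.isClosed.isOpen_compl.preimage continuous_snd).mem_nhds hq]
        with p hp
      exact h0 p.1 p.2 hp
  have hfam : SmoothFamilyOn H univ := smoothFamilyOn_of_contMDiffOn isOpen_univ hs
  have hjc : Continuous fun q : G × Euc n => jet r (H q.1) q.2 := continuous_pi fun j => by
    have := hfam.continuousOn j
    rwa [univ_prod_univ, continuousOn_univ] at this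
  obtain ⟨B, hB⟩ := (isCompact_univ.prod c.isCompact_K).exists_bound_of_continuousOn
    hjc.continuousOn
  refine ⟨max B 0, le_max_right _ _, fun g x => ?_⟩
  by_cases hx : x ∈ c.K
  · exact (hB (g, x) ⟨mem_univ g, hx⟩).trans (le_max_left _ _)
  · have : jet r (H g) x = 0 := jet_eq_zero r fun h => hx
      (closure_minimal (fun y hy => by_contra fun h => Function.mem_support.1 hy (h0 g y h))
        c.isCompact_K.isClosed h)
    change ‖jet r (H g) x‖ ≤ _
    rw [this, norm_zero]
    exact le_max_right _ _

variable [MeasurableSpace G] [BorelSpace G] (μ : Measure G) [IsFiniteMeasure μ] [T2Space M]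

variable (m) in
/-- The average over the group of the regularization of the current `ρ T`. -/
def smoothing (k : ℕ) [ChartedSpace (EuclideanSpace ℝ (Fin k)) G] [LieGroup (𝓡 k) ∞ G]
    [ContMDiffSMul (𝓡 k) (𝓡 n) ∞ G M] (ε : ℝ) : currents n m M →ₗ[ℝ] currents n m M :=
  averagedCurrent μ k c.mem c.isCompact_K c.K_subset_target ∘ₗ c.regularize (c.rOut_bump_le ε)

theorem smoothing_apply (k : ℕ) [ChartedSpace (EuclideanSpace ℝ (Fin k)) G] [LieGroup (𝓡 k) ∞ G]
    [ContMDiffSMul (𝓡 k) (𝓡 n) ∞ G M] (ε : ℝ) (T : currents n m M) (α : testForms n M m) :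
    (c.smoothing m μ k ε T).1 α =
      ∫ g : G, pairing e (c.regularize (c.rOut_bump_le ε) T).1 (translateForm g α.1) ∂μ := rfl

/-- The pairing is bounded by the jet of the localized form, so the bound with `B = 0` makes it
vanish. -/
theorem smoothing_apply_eq_zero (k : ℕ) [ChartedSpace (EuclideanSpace ℝ (Fin k)) G]
    [LieGroup (𝓡 k) ∞ G] [ContMDiffSMul (𝓡 k) (𝓡 n) ∞ G M] (ε : ℝ) (T : currents n m M)
    {α : testForms n M m}
    (h : ∀ g : G, (c.localize (isSmoothForm_translateForm k g α.2.1)).1 = 0) :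
    (c.smoothing m μ k ε T).1 α = 0 := by
  obtain ⟨r, A, -, hA, -⟩ := c.exists_bound_pairing T
  rw [smoothing_apply]
  refine integral_eq_zero_of_ae (Eventually.of_forall fun g => ?_)
  have := hA _ (c.rOut_bump_le ε) _ (isSmoothForm_translateForm k g α.2.1) 0 le_rfl fun x => by
    rw [h g, jet_eq_zero r (by simp [tsupport]), norm_zero]
  rw [mul_zero] at this
  exact abs_nonpos_iff.1 this

end Cutoff

variable {G : Type*} [TopologicalSpace G] [Group G] [MulAction G M] [CompactSpace G] [T2Space G]
  [MeasurableSpace G] [BorelSpace G] (μ : Measure G) [T2Space M]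

/-- If the localizations of the translates of `α` add up, then so do the limits of the
smoothings. -/
theorem tendsto_sum_smoothing [IsProbabilityMeasure μ] (k : ℕ)
    [ChartedSpace (EuclideanSpace ℝ (Fin k)) G]
    [LieGroup (𝓡 k) ∞ G] [ContMDiffSMul (𝓡 k) (𝓡 n) ∞ G M] {ι : Type*}
    {e : ι → OpenPartialHomeomorph M (Euc n)} (c : ∀ i, Cutoff (e i)) (s : Finset ι)
    (T : currents n m M) (α : testForms n M m) (a : ℝ)
    (h : ∀ g : G, ∑ i ∈ s, T.1 (testFormOf (c i).mem (c i).isCompact_L (c i).subset_target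
      ((c i).localize (isSmoothForm_translateForm k g α.2.1))) = a) :
    Tendsto (fun ε => ∑ i ∈ s, ((c i).smoothing m μ k ε T).1 α) (𝓝[>] 0) (𝓝 a) := by
  have hi : ∀ ε i, Integrable (fun g : G => pairing (e i)
      ((c i).regularize ((c i).rOut_bump_le ε) T).1 (translateForm g α.1)) μ := fun ε i =>
    integrable_pairing_translateForm μ k (c i).mem (c i).isCompact_K (c i).K_subset_target _ α.2.1
  have hb : ∀ i, ∃ D : ℝ, ∀ (ε : ℝ) (g : G), |pairing (e i)
      ((c i).regularize ((c i).rOut_bump_le ε) T).1 (translateForm g α.1)| ≤ D := by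
    intro i
    obtain ⟨r, A, -, hA, -⟩ := (c i).exists_bound_pairing T
    obtain ⟨B, hB0, hB⟩ := (c i).exists_bound_jet_localize (G := G) k α.2.1 r
    exact ⟨A * B, fun ε g => hA _ ((c i).rOut_bump_le ε) _
      (isSmoothForm_translateForm k g α.2.1) B hB0 (hB g)⟩
  choose D hD using hb
  have hlim : Tendsto (fun ε => ∫ g : G, ∑ i ∈ s, pairing (e i)
      ((c i).regularize ((c i).rOut_bump_le ε) T).1 (translateForm g α.1) ∂μ) (𝓝[>] 0)
      (𝓝 (∫ _ : G, a ∂μ)) := by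
    -- The constants `D i` do not depend on `ε` or `g`: finite order controls the mollifier, and
    -- compactness of `G` controls the jets of the translates.
    refine tendsto_integral_filter_of_dominated_convergence (fun _ => ∑ i ∈ s, D i)
      (Eventually.of_forall fun ε => (integrable_finsetSum s fun i _ => hi ε i).1)
      (Eventually.of_forall fun ε => Eventually.of_forall fun g => ?_) (integrable_const _)
      (Eventually.of_forall fun g => ?_)
    · exact (norm_sum_le _ _).trans (Finset.sum_le_sum fun i _ => hD i ε g)
    · rw [← h g]
      exact tendsto_finsetSum s fun i _ => (c i).tendsto_pairing_regularize T
        (fun ε => (c i).rOut_bump_le ε) (c i).tendsto_rOut_bump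
        (isSmoothForm_translateForm k g α.2.1)
  have ha : ∫ _ : G, a ∂μ = a := by simp
  rw [ha] at hlim
  refine hlim.congr fun ε => ?_
  rw [integral_finsetSum s fun i _ => hi ε i]
  rfl

end Smoothing

/-! ### Partition of unity and convergence for invariant currents -/

section Approximation

variable {n : ℕ} {M : Type*} [TopologicalSpace M] [ChartedSpace (EuclideanSpace ℝ (Fin n)) M]
  [IsManifold (𝓡 n) ∞ M] [T2Space M]

variable (n M) in
/-- There is a smooth partition of unity by functions with compact support in charts. -/
theorem exists_partition [SecondCountableTopology M] :
    ∃ f : SmoothPartitionOfUnity M (𝓡 n) M univ, ∀ x, HasCompactSupport (f x) ∧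
      tsupport (f x) ⊆ (chartAt (EuclideanSpace ℝ (Fin n)) x).source := by
  have : LocallyCompactSpace M := ChartedSpace.locallyCompactSpace (EuclideanSpace ℝ (Fin n)) M
  have hU : ∀ x : M, ∃ U : Set M, IsOpen U ∧ x ∈ U ∧ IsCompact (closure U) ∧
      closure U ⊆ (chartAt (EuclideanSpace ℝ (Fin n)) x).source := by
    intro x
    obtain ⟨U, hU, hxU, hUs, hUc⟩ := exists_open_between_and_isCompact_closure
      (isCompact_singleton (x := x)) (chartAt (EuclideanSpace ℝ (Fin n)) x).open_source
      (singleton_subset_iff.2 (mem_chart_source _ x))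
    exact ⟨U, hU, singleton_subset_iff.1 hxU, hUc, hUs⟩
  choose U hUo hxU hUc hUs using hU
  obtain ⟨f, hf⟩ := SmoothPartitionOfUnity.exists_isSubordinate (𝓡 n) isClosed_univ U hUo
    fun x _ => mem_iUnion.2 ⟨x, hxU x⟩
  exact ⟨f, fun x => ⟨(hUc x).of_isClosed_subset isClosed_closure
    ((hf x).trans subset_closure), (hf x).trans (subset_closure.trans (hUs x))⟩⟩

/-- A form is the sum of its localizations by a partition of unity. -/
theorem sum_testFormOf_localize {m : ℕ} {ι : Type*} {e : ι → OpenPartialHomeomorph M (Euc n)}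
    (c : ∀ i, Cutoff (e i)) {f : ι → M → ℝ} (hf : ∀ i, ∀ x ∈ (e i).source, (c i).ρ (e i x) = f i x)
    (hfe : ∀ i, ∀ x ∉ (e i).source, f i x = 0) (s : Finset ι) (β : testForms n M m)
    (hs : ∀ x, β.1 x ≠ 0 → ∑ i ∈ s, f i x = 1) :
    ∑ i ∈ s, testFormOf (c i).mem (c i).isCompact_L (c i).subset_target
      ((c i).localize β.2.1) = β := by
  refine Subtype.ext (funext fun x => ?_)
  have h : (∑ i ∈ s, testFormOf (c i).mem (c i).isCompact_L (c i).subset_target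
      ((c i).localize β.2.1)).1 x = ∑ i ∈ s, f i x • β.1 x := by
    rw [Submodule.coe_sum, Finset.sum_apply]
    exact Finset.sum_congr rfl fun i _ => (c i).formOf_localize β.2.1 (hf i) (hfe i) x
  rw [h, ← Finset.sum_smul]
  by_cases hx : β.1 x = 0
  · rw [hx, smul_zero]
  · rw [hs x hx, one_smul]

/-- For a probability measure on the group, the sums of smoothings along a partition of unity
converge to the given invariant current. -/
theorem exists_approximation [SecondCountableTopology M] (m k : ℕ) {G : Type*} [TopologicalSpace G]
    [ChartedSpace (EuclideanSpace ℝ (Fin k)) G] [Group G] [LieGroup (𝓡 k) ∞ G] [T2Space G]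
    [CompactSpace G] [MulAction G M] [ContMDiffSMul (𝓡 k) (𝓡 n) ∞ G M] [MeasurableSpace G]
    [BorelSpace G] (μ : Measure G) [IsProbabilityMeasure μ] :
    ∃ (c : ∀ x : M, Cutoff (chartAt (Euc n) x)) (s : ℝ → Finset M),
      ∀ T : currents n m M, IsInvariantCurrent k G T → ∀ α : testForms n M m,
        Tendsto (fun ε => ∑ x ∈ s ε, ((c x).smoothing m μ k ε T).1 α) (𝓝[>] 0) (𝓝 (T.1 α)) := by
  obtain ⟨f, hf⟩ := exists_partition n M
  have hc : ∀ i : M, ∃ c : Cutoff (chartAt (Euc n) i),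
      ∀ x ∈ (chartAt (Euc n) i).source, c.ρ (chartAt (Euc n) i x) = f i x := fun i =>
    Cutoff.exists_of_tsupport_subset (IsManifold.chart_mem_maximalAtlas i) (f i).contMDiff
      (hf i).1 (hf i).2
  choose c hcf using hc
  have hfe : ∀ i, ∀ x ∉ (chartAt (Euc n) i).source, f i x = 0 := fun i x hx =>
    image_eq_zero_of_notMem_tsupport fun h => hx ((hf i).2 h)
  have : LocallyCompactSpace M := ChartedSpace.locallyCompactSpace (EuclideanSpace ℝ (Fin n)) M
  let K : CompactExhaustion M := default
  have hfin : ∀ {C : Set M}, IsCompact C →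
      {i | (Function.support (f i) ∩ C).Nonempty}.Finite := fun hC =>
    f.locallyFinite.finite_nonempty_inter_compact hC
  -- The index set must depend on `ε` alone, not on `α`: take the members of the partition that meet
  -- the `⌊ε⁻¹⌋₊`-th set of the exhaustion, finitely many by local finiteness.
  refine ⟨c, fun ε => (hfin (K.isCompact ⌊ε⁻¹⌋₊)).toFinset, fun T hT α => ?_⟩
  have : ContinuousSMul G M :=
    ⟨(ContMDiffSMul.contMDiff_smul (I := 𝓡 k) (I' := 𝓡 n) (n := ∞) (G := G) (M := M)).continuous⟩
  -- The orbit of the support of `α` is compact and contains the supports of all translates, so one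
  -- finite index set serves every `g`.
  set C : Set M := (fun q : G × M => q.1 • q.2) '' (univ ×ˢ formSupport α.1) with hCdef
  have hC : IsCompact C := (isCompact_univ.prod α.2.2).image continuous_smul
  have hαC : ∀ (g : G) (x : M), translateForm g α.1 x ≠ 0 → x ∈ C := by
    intro g x hx
    refine ⟨(g⁻¹, g • x), ⟨mem_univ _, subset_closure fun h => hx ?_⟩, inv_smul_smul g x⟩
    change (α.1 (g • x)).compContinuousLinearMap _ = 0
    rw [h]
    rfl
  have hsum : ∀ x ∈ C, ∑ i ∈ (hfin hC).toFinset, f i x = 1 := by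
    intro x hx
    rw [← f.sum_eq_one (mem_univ x)]
    refine (finsum_eq_sum_of_support_subset _ fun i hi => ?_).symm
    simp only [Finite.coe_toFinset]
    exact ⟨x, hi, hx⟩
  have hlim := tendsto_sum_smoothing μ k c (hfin hC).toFinset T α (T.1 α) fun g => by
    have h1 := sum_testFormOf_localize c hcf hfe (hfin hC).toFinset
      (pullback (Diffeomorph.smul (𝓡 k) (𝓡 n) ∞ g) α) fun x hx => hsum x (hαC g x hx)
    have h2 := congrArg T.1 h1
    rw [map_sum] at h2
    -- The localizations sum to `g^* α`, and invariance of `T` makes the limit independent of `g`.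
    exact h2.trans (LinearMap.congr_fun (hT g) α)
  obtain ⟨N, hN⟩ := K.exists_superset_of_isCompact hC
  have hev : ∀ᶠ ε : ℝ in 𝓝[>] 0, N ≤ ⌊ε⁻¹⌋₊ :=
    (tendsto_nat_floor_atTop.comp tendsto_inv_nhdsGT_zero).eventually_ge_atTop N
  -- Once the exhaustion contains `C`, the sum for `ε` differs from the fixed one only by indices
  -- whose functions vanish on `C`; these contribute zero.
  refine hlim.congr' ?_
  filter_upwards [hev] with ε hε
  refine Finset.sum_subset (fun i hi => ?_) fun i _ hi => ?_
  · simp only [Finite.mem_toFinset] at hi ⊢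
    exact hi.mono (inter_subset_inter_right _ (hN.trans (K.subset hε)))
  · refine (c i).smoothing_apply_eq_zero μ k ε T fun g => (c i).localize_eq_zero_of_forall _
      fun x hx hx' => by_contra fun h => hi ?_
    rw [hcf i x hx] at hx'
    simp only [Finite.mem_toFinset]
    exact ⟨x, hx', hαC g x h⟩

end Approximation

end DeRham

end

/-! ### The approximation theorem -/

theorem theorem1p3 (k n m : ℕ)
    (G : Type*) [TopologicalSpace G] [ChartedSpace (EuclideanSpace ℝ (Fin k)) G] [Group G]
    [LieGroup (𝓡 k) ∞ G] [T2Space G] [CompactSpace G]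
    (M : Type*) [TopologicalSpace M] [ChartedSpace (EuclideanSpace ℝ (Fin n)) M]
    [IsManifold (𝓡 n) ∞ M] [T2Space M] [SecondCountableTopology M]
    [MulAction G M] [ContMDiffSMul (𝓡 k) (𝓡 n) ∞ G M] :
    ∃ Z : ℝ → (DeRham.currents n m M →ₗ[ℝ] DeRham.currents n m M),
      ∀ T : DeRham.currents n m M, DeRham.IsInvariantCurrent k G T →
        (∀ ε : ℝ, 0 < ε → DeRham.IsSmoothCurrent (Z ε T)) ∧
        (∀ ε : ℝ, 0 < ε → DeRham.IsInvariantCurrent k G (Z ε T)) ∧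
        ∀ α : DeRham.testForms n M m,
          Tendsto (fun ε => (Z ε T).1 α) (𝓝[>] 0) (𝓝 (T.1 α)) := by
  have : IsTopologicalGroup G := topologicalGroup_of_lieGroup (𝓡 k) ∞
  let _ : MeasurableSpace G := borel G
  have : BorelSpace G := ⟨rfl⟩
  -- Haar measure normalized on the whole compact group: a left invariant probability measure.
  let μ : Measure G := Measure.haarMeasure ⊤
  have : IsProbabilityMeasure μ := ⟨Measure.haarMeasure_self⟩
  obtain ⟨c, s, h⟩ := DeRham.exists_approximation (n := n) (M := M) m k μ
  -- For each `ε` the sum is finite, so smoothness and invariance pass from the summands to the sum.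
  refine ⟨fun ε => ∑ x ∈ s ε, (c x).smoothing m μ k ε,
    fun T hT => ⟨fun ε _ => ?_, fun ε _ => ?_, fun α => ?_⟩⟩
  · rw [LinearMap.sum_apply]
    exact Finset.sum_induction _ DeRham.IsSmoothCurrent (fun _ _ h₁ h₂ => h₁.add h₂)
      DeRham.IsSmoothCurrent.zero fun x _ =>
        DeRham.isSmoothCurrent_averagedCurrent μ k (c x).mem (c x).isCompact_K
          (c x).K_subset_target _
  · rw [LinearMap.sum_apply]
    exact Finset.sum_induction _ (DeRham.IsInvariantCurrent k G) (fun _ _ h₁ h₂ => h₁.add h₂)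
      DeRham.IsInvariantCurrent.zero fun x _ =>
        DeRham.isInvariantCurrent_averagedCurrent μ k (c x).mem (c x).isCompact_K
          (c x).K_subset_target _
  · refine (h T hT α).congr fun ε => ?_
    rw [LinearMap.sum_apply, Submodule.coe_sum, LinearMap.sum_apply]
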